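/- **Setting.** Given a simple graph $G$ on $V=\{0,\dots,n-1\}$ (the positive edges; all other pairs of distinct vertices are negative edges), a *clustering* is a label function $\mathrm{cl}:V\to\mathbb N$. Its *cost* is the number of unordered pairs $\{x,y\}$, $x\ne y$, such that either $\{x,y\}$ is a positive edge and $\mathrm{cl}(x)\neq\mathrm{cl}(y)$, or $\{x,y\}$ is a negative edge and $\mathrm{cl}(x)=\mathrm{cl}(y)$. $\mathrm{OPT}(G)$ is the minimum cost of a clustering, and a clustering is *$(c,\varepsilon)$-approximate* (for MinDisagree) if its cost is at most $c\cdot\mathrm{OPT}(G)+\varepsilon n^2$. The graph is accessed by oracle queries "is $\{x,y\}$ a positive edge?". **Theorem.** 1. (*Upper bound.*) There are a single program for a randomized word RAM with oracle access to $G$, a constant $K$ and a constant $C>0$ such that for every real $\varepsilon\in(0,1)$, every $n\ge 1$ and every graph $G$ on $n$ vertices, the program on input $(n,\lceil 1/\varepsilon\rceil)$ always halts within $C\,n/\varepsilon$ steps and, with probability at least $2/3$, has then stored in memory cells $0,\dots,n-1$ the labels $\mathrm{cl}(0),\dots,\mathrm{cl}(n-1)$ of a $(4,\varepsilon)$-approximate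 clustering of $G$. Here words have $K$ times as many bits as the binary expansion of $n\lceil 1/\varepsilon\rceil$, and each arithmetic operation or comparison on words, memory access, control step, draw of a uniformly random element of $\{0,\dots,m-1\}$ ($m$ a word) and oracle query costs one step. 2. (*Lower bound.*) For all constants $c\ge 1$ and $p>0$ there are $\kappa>0$ and $n_0$, depending only on $c$ and $p$, such that for all $n\ge n_0$ and all $\varepsilon$ with $\frac1n<\varepsilon<\frac1{100c}$ the following holds. Consider any randomized adaptive query algorithm, i.e. any probability distribution on finite decision trees whose nodes query pairs of vertices and whose leaves output clusterings (no restriction on computation, and the algorithm may depend on $n$ and $\varepsilon$). If for every graph $G$ on $n$ vertices it outputs a $(c,\varepsilon)$-approximate clustering of $G$ with probability at least $p$, then on some graph $G$ on $n$ vertices, for some outcome of positive probability of its random choices, it makes at least $\kappa\, n/\varepsilon$ queries. -/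

import Mathlib

namespace CorrClust

/-! ### Correlation clustering (minimising disagreements)

The instance is the graph `G` of positive edges on the vertices `0, …, n - 1`; all other pairs of
distinct vertices are negative edges. A clustering is given by its label function. -/

open Classical in
/-- The number of disagreements of the clustering `cl`: unordered pairs of distinct vertices
(listed with the smaller vertex first) that are a positive edge between two clusters or a
negative edge inside a cluster. -/
noncomputable def cost {n : ℕ} (G : SimpleGraph (Fin n)) (cl : Fin n → ℕ) : ℕ :=
  ((Finset.univ : Finset (Fin n × Fin n)).filter fun e =>
    e.1 < e.2 ∧ ((G.Adj e.1 e.2 ∧ cl e.1 ≠ cl e.2) ∨ (¬ G.Adj e.1 e.2 ∧ cl e.1 = cl e.2))).card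

/-- The smallest number of disagreements of a clustering of `G`. -/
noncomputable def opt {n : ℕ} (G : SimpleGraph (Fin n)) : ℕ :=
  ⨅ cl : Fin n → ℕ, cost G cl

/-- `cl` is a `(c, ε)`-approximate clustering of `G`. -/
def IsApprox {n : ℕ} (G : SimpleGraph (Fin n)) (c ε : ℝ) (cl : Fin n → ℕ) : Prop :=
  (cost G cl : ℝ) ≤ c * (opt G : ℝ) + ε * (n : ℝ) ^ 2

/-! ### The machine: a randomised word RAM with oracle access to the graph -/

/-- Arithmetic and comparison operations of the machine. -/
inductive Op
  | add
  | sub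
  | mul
  | div
  | mod
  | lt
  | eq

/-- Subtraction is truncated, `a / 0 = 0`, `a % 0 = a`, and comparisons return `1` or `0`. -/
def Op.eval : Op → ℕ → ℕ → ℕ
  | .add, a, b => a + b
  | .sub, a, b => a - b
  | .mul, a, b => a * b
  | .div, a, b => a / b
  | .mod, a, b => a % b
  | .lt, a, b => if a < b then 1 else 0
  | .eq, a, b => if a = b then 1 else 0

/-- Programs. Numerals `d`, `a`, `b` are names of registers.
* `set d c`: register `d` receives the constant `c`;
* `op f d a b`: register `d` receives the result of `f` on registers `a`, `b`;
* `load d a`: register `d` receives the memory cell whose address is in register `a`;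
* `store a b`: the memory cell whose address is in register `a` receives register `b`;
* `rand d a`: register `d` receives a fresh uniformly random element of `{0, …, m - 1}`, where
  `m` is the content of register `a` (and receives `0` if `m = 0`);
* `query d x y`: register `d` receives the answer (`1` or `0`) to the oracle query whether the
  vertices whose numbers are in registers `x`, `y` form a positive edge;
* sequencing, branching and looping, where a register is true if it is nonzero. -/
inductive Prog
  | set (d c : ℕ)
  | op (f : Op) (d a b : ℕ)
  | load (d a : ℕ)
  | store (a b : ℕ)
  | rand (d a : ℕ)
  | query (d x y : ℕ)
  | seq (P Q : Prog)
  | ite (a : ℕ) (P Q : Prog)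
  | loop (a : ℕ) (P : Prog)

/-- Registers and random access memory. -/
structure Store where
  reg : ℕ → ℕ
  mem : ℕ → ℕ

/-- Write to a register; words are numbers below `2 ^ w`, and overflow wraps around. -/
def Store.setReg (w : ℕ) (s : Store) (d v : ℕ) : Store :=
  { s with reg := Function.update s.reg d (v % 2 ^ w) }

/-- Write to a memory cell. -/
def Store.setMem (s : Store) (i v : ℕ) : Store :=
  { s with mem := Function.update s.mem i v }

/-- A configuration: the stack of programs that remain to be executed, and the store.
The machine has halted when the stack is empty. -/
structure Config where
  todo : List Prog
  store : Store

open Classical in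
/-- The answer of the oracle (`0` if the two numbers do not both name vertices). -/
noncomputable def oracle {n : ℕ} (G : SimpleGraph (Fin n)) (x y : ℕ) : ℕ :=
  if ∃ (hx : x < n) (hy : y < n), G.Adj ⟨x, hx⟩ ⟨y, hy⟩ then 1 else 0

/-- The uniform distribution on `{0, …, m - 1}` (for `m = 0`: the point mass at `0`). -/
noncomputable def uniformBelow (m : ℕ) : PMF ℕ :=
  (PMF.uniformOfFintype (Fin (m - 1 + 1))).map Fin.val

/-- One time step of the machine with word length `w` and oracle `G`. -/
noncomputable def step {n : ℕ} (w : ℕ) (G : SimpleGraph (Fin n)) : Config → PMF Config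
  | ⟨[], s⟩ => PMF.pure ⟨[], s⟩
  | ⟨.set d c :: k, s⟩ => PMF.pure ⟨k, s.setReg w d c⟩
  | ⟨.op f d a b :: k, s⟩ => PMF.pure ⟨k, s.setReg w d (f.eval (s.reg a) (s.reg b))⟩
  | ⟨.load d a :: k, s⟩ => PMF.pure ⟨k, s.setReg w d (s.mem (s.reg a))⟩
  | ⟨.store a b :: k, s⟩ => PMF.pure ⟨k, s.setMem (s.reg a) (s.reg b)⟩
  | ⟨.rand d a :: k, s⟩ => (uniformBelow (s.reg a)).map fun r => ⟨k, s.setReg w d r⟩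
  | ⟨.query d x y :: k, s⟩ => PMF.pure ⟨k, s.setReg w d (oracle G (s.reg x) (s.reg y))⟩
  | ⟨.seq P Q :: k, s⟩ => PMF.pure ⟨P :: Q :: k, s⟩
  | ⟨.ite a P Q :: k, s⟩ => PMF.pure ⟨(if s.reg a ≠ 0 then P else Q) :: k, s⟩
  | ⟨.loop a P :: k, s⟩ => PMF.pure ⟨if s.reg a ≠ 0 then P :: .loop a P :: k else k, s⟩

/-- The distribution of the configuration after `t` time steps. -/
noncomputable def run {n : ℕ} (w : ℕ) (G : SimpleGraph (Fin n)) : ℕ → Config → PMF Config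
  | 0, C => PMF.pure C
  | t + 1, C => (step w G C).bind (run w G t)

/-- The start of `P` on input `(n, N)`: registers `0` and `1` hold `n` and `N`, everything else
is `0`. -/
def start (P : Prog) (n N : ℕ) : Config :=
  ⟨[P], ⟨fun i => if i = 0 then n else if i = 1 then N else 0, fun _ => 0⟩⟩

/-- The machine has halted. -/
def Config.Halted (C : Config) : Prop := C.todo = []

/-- The clustering that is stored explicitly: the label of the vertex `v` is in memory cell `v`. -/
def Config.clustering (C : Config) (n : ℕ) : Fin n → ℕ := fun v => C.store.mem v

/-- The word length is `K` times the number of binary digits of `n * N`. -/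
def wordLength (K n N : ℕ) : ℕ := K * Nat.size (n * N)

/-! ### Query algorithms without any computational restriction -/

/-- Deterministic adaptive query algorithms for graphs on `n` vertices: either output a
clustering, or ask whether `{x, y}` is a positive edge and continue according to the answer.
A randomised algorithm (the random bits being drawn in advance) is a probability distribution on
these; there are only countably many of them, so every such distribution is a `PMF`. -/
inductive QueryAlg (n : ℕ)
  | output (cl : Fin n → ℕ)
  | ask (x y : Fin n) (no yes : QueryAlg n)

open Classical in
/-- The clustering that the algorithm outputs on the graph `G`. -/
noncomputable def QueryAlg.result {n : ℕ} (G : SimpleGraph (Fin n)) : QueryAlg n → (Fin n → ℕ)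
  | .output cl => cl
  | .ask x y no yes => if G.Adj x y then yes.result G else no.result G

open Classical in
/-- The number of queries that the algorithm makes on the graph `G`. -/
noncomputable def QueryAlg.queries {n : ℕ} (G : SimpleGraph (Fin n)) : QueryAlg n → ℕ
  | .output _ => 0
  | .ask x y no yes => (if G.Adj x y then yes.queries G else no.queries G) + 1

end CorrClust

/-!
# Correlation clustering with few queries

**Upper bound.** One run of the truncated pivot algorithm draws `N = ⌈1 / ε⌉` uniformly random
vertices; each of them that is still unclustered forms a cluster with its unclustered neighbours, and
vertices left over at the end are singletons. A round with pivot `u` creates one disagreement for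
each bad triple (two positive edges and one negative) formed by `u` and two further unclustered
vertices, and it removes from play the pair opposite to `u`. Every bad triple contains a disagreement
of an optimal clustering, so that at most three disagreements are created per removed disagreement
of the optimum, on average over `u` (`sum_badTriple_le`, `sum_settled_step`). The edges left among
unclustered vertices are few, as each round removes the unclustered neighbours of the pivot
(`expect_openEdges_le`). Hence the expected cost is at most `3 * opt + n ^ 2 / (2 * N)`
(`expect_pairCost_le`), and by Markov's inequality a run is good with probability at least `1 / 7`.
The factor `4` leaves room to recognise a good run: the costs of 16 runs are estimated by sampling
`2 ^ 20 * N` pairs each, and Chernoff bounds show that the run with the smallest count is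
sufficient with probability at least `2 / 3` (`expect_best_bad_le`).

The machine is treated with a small program logic. `Sim` says that a program halts within a given
number of steps and that its final store represents a random element of a given distribution; it
composes along sequencing and counter-controlled loops. Assigning the value `∞` to configurations
that have not halted lets a single expectation bound yield both the termination and the success
probability (`clusterProg_correct`).

**Lower bound.** The hard instances are disjoint unions of `k ≈ 1 / (20 * ε)` cliques, where the
cliques of at most half of the vertices are public and each other vertex chooses one of the `k`
cliques independently. The optimum is `0`, so `c` plays no role. An output determines a guess for the
clique of each vertex such that a wrong guess costs at least the size of the public part of a clique
(`mul_wrong_le_cost`); an approximate clustering thus guesses all but `n / 9` vertices correctly. On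
the other hand a query improves the bound for the expectation of `2 ^ (-wrong)` by a factor of at most
`1 + 4 / k` (`sum_wrong_le`), as each answer "yes" settles vertices for which only one of `k` choices
is right. With fewer than `n / (10000 * ε)` queries the probability of success, averaged over the
instances, is therefore exponentially small in `n` (`success_le`).
-/

namespace CorrClust

/-! ### Expectations with respect to discrete distributions -/

/-- The expectation of `f`, with values in `[0, ∞]`, under the discrete distribution `μ`. -/
noncomputable def expect {α : Type*} (μ : PMF α) (f : α → ENNReal) : ENNReal :=
  ∑' a, μ a * f a

section Expect

variable {α β : Type*}

@[simp]
theorem expect_pure (a : α) (f : α → ENNReal) : expect (PMF.pure a) f = f a := by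
  classical
  unfold expect
  rw [tsum_eq_single a]
  · simp
  · intro b hb
    simp [PMF.pure_apply, hb]

theorem expect_bind (μ : PMF α) (ν : α → PMF β) (f : β → ENNReal) :
    expect (μ.bind ν) f = expect μ fun a => expect (ν a) f := by
  unfold expect
  simp_rw [PMF.bind_apply, ← ENNReal.tsum_mul_right, ← ENNReal.tsum_mul_left]
  rw [ENNReal.tsum_comm]
  simp_rw [mul_assoc]

theorem expect_map (μ : PMF α) (g : α → β) (f : β → ENNReal) :
    expect (μ.map g) f = expect μ fun a => f (g a) := by
  simp only [PMF.map, expect_bind, Function.comp_apply, expect_pure]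

theorem expect_mono (μ : PMF α) {f g : α → ENNReal} (h : ∀ a, f a ≤ g a) :
    expect μ f ≤ expect μ g :=
  ENNReal.tsum_le_tsum fun a => mul_le_mul_right (h a) _

theorem expect_add (μ : PMF α) (f g : α → ENNReal) :
    expect μ (fun a => f a + g a) = expect μ f + expect μ g := by
  simp only [expect, mul_add, ENNReal.tsum_add]

theorem expect_mul_left (μ : PMF α) (c : ENNReal) (f : α → ENNReal) :
    expect μ (fun a => c * f a) = c * expect μ f := by
  simp only [expect, mul_left_comm _ c, ENNReal.tsum_mul_left]

theorem expect_const (μ : PMF α) (c : ENNReal) : expect μ (fun _ => c) = c := by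
  simp only [expect, ENNReal.tsum_mul_right, PMF.tsum_coe, one_mul]

theorem expect_le_of_le (μ : PMF α) {f : α → ENNReal} {c : ENNReal} (h : ∀ a, f a ≤ c) :
    expect μ f ≤ c :=
  (expect_mono μ h).trans (expect_const μ c).le

theorem expect_uniform {n : ℕ} [NeZero n] (f : Fin n → ENNReal) :
    expect (PMF.uniformOfFintype (Fin n)) f = (∑ u, f u) / n := by
  simp only [expect, tsum_fintype, PMF.uniformOfFintype_apply, Fintype.card_fin,
    ← Finset.mul_sum]
  rw [div_eq_mul_inv, mul_comm]

theorem uniformBelow_eq (n : ℕ) [NeZero n] :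
    uniformBelow n = (PMF.uniformOfFintype (Fin n)).map Fin.val := by
  obtain ⟨k, rfl⟩ := Nat.exists_eq_succ_of_ne_zero (NeZero.ne n)
  rfl

end Expect

/-! ### A program logic for the machine -/

section Machine

variable {n : ℕ} (w : ℕ) (G : SimpleGraph (Fin n))

/-- The expectation of `φ` after `T` steps of the machine. -/
noncomputable def value (φ : Config → ENNReal) (T : ℕ) (C : Config) : ENNReal :=
  expect (run w G T C) φ

variable (φ : Config → ENNReal) (T : ℕ) (k : List Prog) (s : Store)

theorem value_zero (C : Config) : value w G φ 0 C = φ C := by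
  simp [value, run]

theorem value_succ (C : Config) :
    value w G φ (T + 1) C = expect (step w G C) (value w G φ T) := by
  simp only [value, run, expect_bind]
  rfl

theorem value_halted : value w G φ T ⟨[], s⟩ = φ ⟨[], s⟩ := by
  induction T with
  | zero => exact value_zero ..
  | succ T ih => rw [value_succ, step, expect_pure, ih]

theorem value_set (d c : ℕ) :
    value w G φ (T + 1) ⟨.set d c :: k, s⟩ = value w G φ T ⟨k, s.setReg w d c⟩ := by
  rw [value_succ, step, expect_pure]

theorem value_op (f : Op) (d a b : ℕ) :
    value w G φ (T + 1) ⟨.op f d a b :: k, s⟩ =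
      value w G φ T ⟨k, s.setReg w d (f.eval (s.reg a) (s.reg b))⟩ := by
  rw [value_succ, step, expect_pure]

theorem value_load (d a : ℕ) :
    value w G φ (T + 1) ⟨.load d a :: k, s⟩ =
      value w G φ T ⟨k, s.setReg w d (s.mem (s.reg a))⟩ := by
  rw [value_succ, step, expect_pure]

theorem value_store (a b : ℕ) :
    value w G φ (T + 1) ⟨.store a b :: k, s⟩ =
      value w G φ T ⟨k, s.setMem (s.reg a) (s.reg b)⟩ := by
  rw [value_succ, step, expect_pure]

theorem value_query (d x y : ℕ) :
    value w G φ (T + 1) ⟨.query d x y :: k, s⟩ =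
      value w G φ T ⟨k, s.setReg w d (oracle G (s.reg x) (s.reg y))⟩ := by
  rw [value_succ, step, expect_pure]

theorem value_rand [NeZero n] (d a : ℕ) (ha : s.reg a = n) :
    value w G φ (T + 1) ⟨.rand d a :: k, s⟩ =
      expect (PMF.uniformOfFintype (Fin n)) fun u =>
        value w G φ T ⟨k, s.setReg w d u⟩ := by
  rw [value_succ, step, expect_map, ha, uniformBelow_eq, expect_map]

theorem value_seq (P Q : Prog) :
    value w G φ (T + 1) ⟨.seq P Q :: k, s⟩ = value w G φ T ⟨P :: Q :: k, s⟩ := by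
  rw [value_succ, step, expect_pure]

theorem value_ite_of_ne (a : ℕ) (P Q : Prog) (h : s.reg a ≠ 0) :
    value w G φ (T + 1) ⟨.ite a P Q :: k, s⟩ = value w G φ T ⟨P :: k, s⟩ := by
  rw [value_succ, step, expect_pure, if_pos h]

theorem value_ite_of_eq (a : ℕ) (P Q : Prog) (h : s.reg a = 0) :
    value w G φ (T + 1) ⟨.ite a P Q :: k, s⟩ = value w G φ T ⟨Q :: k, s⟩ := by
  rw [value_succ, step, expect_pure, if_neg (not_not.2 h)]

theorem value_loop_of_ne (a : ℕ) (P : Prog) (h : s.reg a ≠ 0) :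
    value w G φ (T + 1) ⟨.loop a P :: k, s⟩ = value w G φ T ⟨P :: .loop a P :: k, s⟩ := by
  rw [value_succ, step, expect_pure, if_pos h]

theorem value_loop_of_eq (a : ℕ) (P : Prog) (h : s.reg a = 0) :
    value w G φ (T + 1) ⟨.loop a P :: k, s⟩ = value w G φ T ⟨k, s⟩ := by
  rw [value_succ, step, expect_pure, if_neg (not_not.2 h)]

/-- `Sim w G P t s μ R`: started in the store `s`, the program `P` terminates within `t` steps, and
its final store represents, in the sense of `R`, a random element of distribution `μ`.

The definition is in continuation-passing style: whatever stack `k` of programs follows, an upper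
bound `f` for the continuation in terms of the represented element yields the upper bound
`expect μ f` for the whole. -/
def Sim {α : Type*} (P : Prog) (t : ℕ) (s : Store) (μ : PMF α) (R : α → Store → Prop) : Prop :=
  ∀ (k : List Prog) (φ : Config → ENNReal) (T : ℕ) (f : α → ENNReal),
    (∀ T', T ≤ T' → ∀ a s', R a s' → value w G φ T' ⟨k, s'⟩ ≤ f a) →
    ∀ T', T + t ≤ T' → value w G φ T' ⟨P :: k, s⟩ ≤ expect μ f

variable {w G s}

theorem Sim.mono {α : Type*} {P : Prog} {t t' : ℕ} {μ : PMF α} {R R' : α → Store → Prop}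
    (h : Sim w G P t s μ R) (ht : t ≤ t') (hR : ∀ a s', R a s' → R' a s') :
    Sim w G P t' s μ R' := by
  intro k φ T f hf T' hT'
  exact h k φ T f (fun T'' h'' a s' ha => hf T'' h'' a s' (hR a s' ha)) T' (by omega)

theorem Sim.seq {α β : Type*} {P Q : Prog} {t t' : ℕ} {μ : PMF α} {ν : α → PMF β}
    {R : α → Store → Prop} {R' : β → Store → Prop} (h : Sim w G P t s μ R)
    (h' : ∀ a s', R a s' → Sim w G Q t' s' (ν a) R') :
    Sim w G (.seq P Q) (t + t' + 1) s (μ.bind ν) R' := by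
  intro k φ T f hf T' hT'
  obtain ⟨T'', rfl⟩ : ∃ T'', T' = T'' + 1 := ⟨T' - 1, by omega⟩
  rw [value_seq, expect_bind]
  exact h (Q :: k) φ (T + t') _
    (fun T₁ h₁ a s' ha => h' a s' ha k φ T f hf T₁ h₁) T'' (by omega)

/-- Sequencing after a part with a deterministic effect. -/
theorem Sim.seq_pure {α β : Type*} {P Q : Prog} {t t' : ℕ} {a : α} {μ : PMF β}
    {R : α → Store → Prop} {R' : β → Store → Prop} (h : Sim w G P t s (PMF.pure a) R)
    (h' : ∀ s', R a s' → Sim w G Q t' s' μ R') :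
    Sim w G (.seq P Q) (t + t' + 1) s μ R' := by
  intro k φ T f hf T' hT'
  obtain ⟨T'', rfl⟩ : ∃ T'', T' = T'' + 1 := ⟨T' - 1, by omega⟩
  rw [value_seq]
  classical
  have := h (Q :: k) φ (T + t') (fun b => if b = a then expect μ f else ⊤)
    (fun T₁ h₁ b s' hb => by
      by_cases hba : b = a
      · subst hba
        simpa using h' s' hb k φ T f hf T₁ h₁
      · simp [hba]) T'' (by omega)
  simpa using this

/-- The distribution after `i` steps of the Markov chain with transition kernel `ν`. -/
noncomputable def iterate {α : Type*} (ν : α → PMF α) : ℕ → α → PMF α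
  | 0, a => PMF.pure a
  | i + 1, a => (ν a).bind (iterate ν i)

theorem iterate_pure {α : Type*} (i : ℕ) (a : α) : iterate (fun a : α => PMF.pure a) i a =
    PMF.pure a := by
  induction i with
  | zero => rfl
  | succ i ih => rw [iterate, PMF.pure_bind, ih]

/-- The rule for loops that are controlled by a counter. `I i` is the invariant for `i` remaining
rounds. -/
theorem Sim.loop {α : Type*} {a : ℕ} {P : Prog} {t : ℕ} (I : ℕ → α → Store → Prop)
    (ν : α → PMF α) (h0 : ∀ x s, I 0 x s → s.reg a = 0)
    (h1 : ∀ i x s, I (i + 1) x s → s.reg a ≠ 0)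
    (hs : ∀ i x s, I (i + 1) x s → Sim w G P t s (ν x) (I i)) :
    ∀ i x s, I i x s → Sim w G (.loop a P) (i * (t + 1) + 1) s (iterate ν i x) (I 0) := by
  intro i
  induction i with
  | zero =>
    intro x s hx k φ T f hf T' hT'
    obtain ⟨T'', rfl⟩ : ∃ T'', T' = T'' + 1 := ⟨T' - 1, by omega⟩
    rw [value_loop_of_eq _ _ _ _ _ _ _ _ (h0 x s hx), iterate, expect_pure]
    exact hf _ (by omega) x s hx
  | succ i ih =>
    intro x s hx k φ T f hf T' hT'
    obtain ⟨T'', rfl⟩ : ∃ T'', T' = T'' + 1 := ⟨T' - 1, by omega⟩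
    rw [value_loop_of_ne _ _ _ _ _ _ _ _ (h1 i x s hx), iterate, expect_bind]
    refine hs i x s hx _ φ (T + (i * (t + 1) + 1)) _
      (fun T₁ hT₁ y s' hy => ih y s' hy k φ T f hf T₁ hT₁) T'' ?_
    have : (i + 1) * (t + 1) = i * (t + 1) + (t + 1) := by ring
    omega

/-- The rule for counter-controlled loops with a deterministic effect. -/
theorem Sim.loop_pure {a : ℕ} {P : Prog} {t : ℕ} (I : ℕ → Store → Prop)
    (h0 : ∀ s, I 0 s → s.reg a = 0) (h1 : ∀ i s, I (i + 1) s → s.reg a ≠ 0)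
    (hs : ∀ i s, I (i + 1) s → Sim w G P t s (PMF.pure ()) fun _ => I i) (i : ℕ) (hi : I i s) :
    Sim w G (.loop a P) (i * (t + 1) + 1) s (PMF.pure ()) fun _ => I 0 := by
  have := Sim.loop (w := w) (G := G) (a := a) (P := P) (t := t) (fun i (_ : Unit) => I i)
    (fun x => PMF.pure x) (fun _ => h0) (fun i _ => h1 i) (fun i _ => hs i) i () s hi
  rwa [iterate_pure] at this

end Machine

/-! ### The truncated pivot algorithm -/

section Pivot

variable {n : ℕ}

/-- The pair `x, y` is a disagreement of the clustering `L`. -/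
def Disagree (G : SimpleGraph (Fin n)) (L : Fin n → ℕ) (x y : Fin n) : Prop :=
  x ≠ y ∧ ((G.Adj x y ∧ L x ≠ L y) ∨ (¬ G.Adj x y ∧ L x = L y))

/-- The three vertices span exactly two positive edges; every clustering has a disagreement on
such a triple. -/
def BadTriple (G : SimpleGraph (Fin n)) (u x y : Fin n) : Prop :=
  u ≠ x ∧ u ≠ y ∧ x ≠ y ∧ ((G.Adj u x ∧ G.Adj u y ∧ ¬ G.Adj x y) ∨
    (G.Adj u x ∧ ¬ G.Adj u y ∧ G.Adj x y) ∨ (¬ G.Adj u x ∧ G.Adj u y ∧ G.Adj x y))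

open Classical in
/-- One round of the pivot algorithm with the vertex `u`. A label `n ≤ L v` says that `v` is not yet
clustered (its label is then `n + v`, so that it counts as a singleton); the cluster of a pivot is
labelled with the pivot. A vertex that is already clustered does not become a pivot. -/
noncomputable def pivotStep (G : SimpleGraph (Fin n)) (L : Fin n → ℕ) (u : Fin n) : Fin n → ℕ :=
  if n ≤ L u then fun v => if v = u ∨ (n ≤ L v ∧ G.Adj u v) then u else L v else L

/-- The labels that the pivot algorithm produces: `n + v` for an unclustered vertex `v`, and
otherwise a pivot, which belongs to its own cluster. -/
def PivotLabels (L : Fin n → ℕ) : Prop :=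
  ∀ v, L v = n + v ∨ ∃ p : Fin n, L v = p ∧ L p = p

theorem pivotLabels_init : PivotLabels fun v : Fin n => n + (v : ℕ) := fun _ => Or.inl rfl

theorem PivotLabels.lt {L : Fin n → ℕ} (h : PivotLabels L) (v : Fin n) : L v < 2 * n := by
  have := v.2
  rcases h v with h | ⟨p, h, -⟩
  · omega
  · have := p.2
    omega

theorem PivotLabels.step {L : Fin n → ℕ} (h : PivotLabels L) (G : SimpleGraph (Fin n))
    (u : Fin n) : PivotLabels (pivotStep G L u) := by
  intro v
  unfold pivotStep
  split_ifs with hu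
  · by_cases hv : v = u ∨ (n ≤ L v ∧ G.Adj u v)
    · exact Or.inr ⟨u, if_pos hv, if_pos (Or.inl rfl)⟩
    · rcases h v with h1 | ⟨p, h1, h2⟩
      · exact Or.inl ((if_neg hv).trans h1)
      · refine Or.inr ⟨p, (if_neg hv).trans h1, ?_⟩
        have hp : ¬ (p = u ∨ (n ≤ L p ∧ G.Adj u p)) := by
          have := p.2
          rintro (rfl | ⟨h3, -⟩) <;> omega
        exact (if_neg hp).trans h2
  · exact h v

open Classical in
/-- Ordered pairs that disagree and are not both unclustered. -/
noncomputable def settled (G : SimpleGraph (Fin n)) (L : Fin n → ℕ) : ℕ :=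
  ∑ x, ∑ y, if Disagree G L x y ∧ ¬ (n ≤ L x ∧ n ≤ L y) then 1 else 0

open Classical in
/-- Ordered pairs of unclustered vertices that are a disagreement of the clustering `cl`. -/
noncomputable def openDisagree (G : SimpleGraph (Fin n)) (cl L : Fin n → ℕ) : ℕ :=
  ∑ x, ∑ y, if n ≤ L x ∧ n ≤ L y ∧ Disagree G cl x y then 1 else 0

open Classical in
/-- Ordered pairs of unclustered vertices that are a positive edge. -/
noncomputable def openEdges (G : SimpleGraph (Fin n)) (L : Fin n → ℕ) : ℕ :=
  ∑ x, ∑ y, if n ≤ L x ∧ n ≤ L y ∧ G.Adj x y then 1 else 0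

open Classical in
/-- The number of unclustered vertices. -/
noncomputable def openCount (L : Fin n → ℕ) : ℕ :=
  ∑ x, if n ≤ L x then 1 else 0

open Classical in
/-- The number of ordered pairs that are a disagreement. -/
noncomputable def pairCost (G : SimpleGraph (Fin n)) (L : Fin n → ℕ) : ℕ :=
  ∑ x, ∑ y, if Disagree G L x y then 1 else 0

theorem Disagree.symm {G : SimpleGraph (Fin n)} {L : Fin n → ℕ} {x y : Fin n}
    (h : Disagree G L x y) : Disagree G L y x := by
  obtain ⟨h1, h2⟩ := h
  refine ⟨h1.symm, ?_⟩
  rwa [G.adj_comm, ne_comm, eq_comm (a := L y)]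

theorem pairCost_eq (G : SimpleGraph (Fin n)) (L : Fin n → ℕ) : pairCost G L = 2 * cost G L := by
  classical
  unfold pairCost cost
  rw [← Finset.sum_product', Finset.univ_product_univ, ← Finset.card_filter, two_mul]
  have h1 : (Finset.univ.filter fun e : Fin n × Fin n => Disagree G L e.1 e.2) =
      (Finset.univ.filter fun e : Fin n × Fin n => e.1 < e.2 ∧ Disagree G L e.1 e.2) ∪
      (Finset.univ.filter fun e : Fin n × Fin n => e.2 < e.1 ∧ Disagree G L e.1 e.2) := by
    ext e
    simp only [Finset.mem_filter, Finset.mem_univ, true_and, Finset.mem_union]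
    constructor
    · intro h
      rcases lt_or_gt_of_ne h.1 with h2 | h2
      · exact Or.inl ⟨h2, h⟩
      · exact Or.inr ⟨h2, h⟩
    · rintro (h | h)
      · exact h.2
      · exact h.2
  rw [h1, Finset.card_union_of_disjoint]
  · congr 1
    · congr 1
      ext e
      simp only [Finset.mem_filter, Finset.mem_univ, true_and]
      exact ⟨fun h => ⟨h.1, h.2.2⟩, fun h => ⟨h.1, h.1.ne, h.2⟩⟩
    · refine Finset.card_bij (fun e _ => e.swap) ?_ ?_ ?_
      · intro e he
        simp only [Finset.mem_filter, Finset.mem_univ, true_and] at he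
        simp only [Finset.mem_filter, Finset.mem_univ, true_and, Prod.fst_swap, Prod.snd_swap]
        exact ⟨he.1, he.2.symm.2⟩
      · intro a _ b _ hab
        exact Prod.swap_injective hab
      · intro e he
        simp only [Finset.mem_filter, Finset.mem_univ, true_and] at he
        refine ⟨e.swap, ?_, Prod.swap_swap e⟩
        simp only [Finset.mem_filter, Finset.mem_univ, true_and, Prod.fst_swap, Prod.snd_swap]
        exact ⟨he.1, Disagree.symm ⟨he.1.ne, he.2⟩⟩
  · rw [Finset.disjoint_filter]
    rintro e - h1 h2
    exact absurd h1.1 h2.1.not_gt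

variable (G : SimpleGraph (Fin n)) (cl : Fin n → ℕ) {L : Fin n → ℕ}

theorem pairCost_eq_settled_add (h : PivotLabels L) :
    pairCost G L = settled G L + openEdges G L := by
  unfold pairCost settled openEdges
  simp only [← Finset.sum_add_distrib]
  refine Finset.sum_congr rfl fun x _ => Finset.sum_congr rfl fun y _ => ?_
  by_cases hxy : n ≤ L x ∧ n ≤ L y
  · have hne : L x = L y ↔ x = y := by
      rcases h x with h1 | ⟨p, h1, -⟩
      · rcases h y with h2 | ⟨p, h2, -⟩
        · rw [h1, h2, Fin.ext_iff]; omega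
        · have := p.2; omega
      · have := p.2; omega
    have : Disagree G L x y ↔ G.Adj x y := by
      unfold Disagree
      rw [hne]
      have := @SimpleGraph.Adj.ne _ G x y
      tauto
    grind
  · grind

/-- A round with pivot `u` settles as disagreements the pairs that form a bad triple with `u`. -/
theorem settled_pair_step (h : PivotLabels L) (u x y : Fin n) :
    (Disagree G (pivotStep G L u) x y ∧ ¬ (n ≤ pivotStep G L u x ∧ n ≤ pivotStep G L u y)) ↔
      ((Disagree G L x y ∧ ¬ (n ≤ L x ∧ n ≤ L y)) ∨
        (n ≤ L u ∧ n ≤ L x ∧ n ≤ L y ∧ BadTriple G u x y)) := by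
  by_cases hu : n ≤ L u
  · have hfree : ∀ v, L v ≠ u := by
      intro v hv
      have := u.2
      rcases h v with h1 | ⟨p, h1, h2⟩
      · omega
      · have : p = u := Fin.ext (by omega)
        subst this
        omega
    have hx := hfree x
    have hy := hfree y
    have hlt := u.2
    have hxy : n ≤ L x → n ≤ L y → (L x = L y ↔ x = y) := by
      intro h1 h2
      rcases h x with h3 | ⟨p, h3, -⟩
      · rcases h y with h4 | ⟨p, h4, -⟩
        · rw [h3, h4, Fin.ext_iff]; omega
        · have := p.2; omega
      · have := p.2; omega
    have e1 := G.adj_comm x u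
    have e2 := G.adj_comm y u
    have e3 := @SimpleGraph.Adj.ne _ G x y
    have e4 := @SimpleGraph.Adj.ne _ G u x
    have e5 := @SimpleGraph.Adj.ne _ G u y
    simp only [pivotStep, hu, if_true, Disagree, BadTriple]
    grind
  · simp [pivotStep, hu]

/-- The pairs that a pivot `u` removes from the unclustered part include those that form a bad
triple with it. -/
theorem open_pair_step (P : Prop) (u x y : Fin n) :
    ((n ≤ pivotStep G L u x ∧ n ≤ pivotStep G L u y ∧ P) →
      (n ≤ L x ∧ n ≤ L y ∧ P)) ∧
    ((n ≤ pivotStep G L u x ∧ n ≤ pivotStep G L u y ∧ P) →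
      ¬ (n ≤ L u ∧ n ≤ L x ∧ n ≤ L y ∧ BadTriple G u x y)) := by
  have hlt := u.2
  by_cases hu : n ≤ L u
  · simp only [pivotStep, hu, if_true, BadTriple]
    grind
  · simp [pivotStep, hu]

theorem BadTriple.disagree {G : SimpleGraph (Fin n)} {u x y : Fin n} (h : BadTriple G u x y) :
    Disagree G cl x y ∨ Disagree G cl u x ∨ Disagree G cl u y := by
  unfold BadTriple at h
  unfold Disagree
  grind

theorem BadTriple.rotate {G : SimpleGraph (Fin n)} {u x y : Fin n} (h : BadTriple G u x y) :
    BadTriple G y u x := by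
  unfold BadTriple at *
  have e1 := G.adj_comm x y
  have e2 := G.adj_comm u y
  grind

theorem BadTriple.swap {G : SimpleGraph (Fin n)} {u x y : Fin n} (h : BadTriple G u x y) :
    BadTriple G u y x := by
  unfold BadTriple at *
  have e1 := G.adj_comm x y
  grind

open Classical in
/-- Charging bad triples to the disagreements of `cl`: among the unclustered vertices, a third of the
bad triples (at least) have a disagreement of `cl` at the pair opposite to the first vertex. -/
theorem sum_badTriple_le :
    ∑ u, ∑ x, ∑ y, (if n ≤ L u ∧ n ≤ L x ∧ n ≤ L y ∧ BadTriple G u x y then 1 else 0) ≤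
      3 * ∑ u, ∑ x, ∑ y, (if (n ≤ L u ∧ n ≤ L x ∧ n ≤ L y ∧ BadTriple G u x y) ∧
        Disagree G cl x y then 1 else 0) := by
  set B : Fin n → Fin n → Fin n → Prop :=
    fun u x y => n ≤ L u ∧ n ≤ L x ∧ n ≤ L y ∧ BadTriple G u x y
  have hrot : ∀ u x y, B u x y → B y u x := fun u x y h => ⟨h.2.2.1, h.1, h.2.1, h.2.2.2.rotate⟩
  have hswap : ∀ u x y, B u x y → B u y x :=
    fun u x y h => ⟨h.1, h.2.2.1, h.2.1, h.2.2.2.swap⟩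
  have h1 : ∑ u, ∑ x, ∑ y, (if B u x y ∧ Disagree G cl u x then 1 else 0) =
      ∑ u, ∑ x, ∑ y, (if B u x y ∧ Disagree G cl x y then 1 else 0) := by
    rw [Finset.sum_congr rfl fun u _ => Finset.sum_comm, Finset.sum_comm]
    refine Finset.sum_congr rfl fun y _ => Finset.sum_congr rfl fun u _ =>
      Finset.sum_congr rfl fun x _ => ?_
    have : B u x y ↔ B y u x := ⟨hrot _ _ _, fun h => hrot _ _ _ (hrot _ _ _ h)⟩
    simp only [this]
  have h2 : ∑ u, ∑ x, ∑ y, (if B u x y ∧ Disagree G cl u y then 1 else 0) =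
      ∑ u, ∑ x, ∑ y, (if B u x y ∧ Disagree G cl x y then 1 else 0) := by
    rw [Finset.sum_comm]
    refine Finset.sum_congr rfl fun x _ => Finset.sum_congr rfl fun u _ =>
      Finset.sum_congr rfl fun y _ => ?_
    have : B u x y ↔ B x u y := ⟨fun h => hswap _ _ _ (hrot _ _ _ (hrot _ _ _ h)),
      fun h => hswap _ _ _ (hrot _ _ _ (hrot _ _ _ h))⟩
    simp only [this]
  calc _ ≤ ∑ u, ∑ x, ∑ y, ((if B u x y ∧ Disagree G cl x y then 1 else 0) +
        (if B u x y ∧ Disagree G cl u x then 1 else 0) +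
        (if B u x y ∧ Disagree G cl u y then 1 else 0)) := by
        refine Finset.sum_le_sum fun u _ => Finset.sum_le_sum fun x _ =>
          Finset.sum_le_sum fun y _ => ?_
        change (if B u x y then 1 else 0) ≤ _
        by_cases hB : B u x y
        · rcases hB.2.2.2.disagree cl with h | h | h <;> simp only [hB, h] <;> grind
        · simp [hB]
    _ = _ := by
        simp only [Finset.sum_add_distrib]
        rw [h1, h2]
        ring

/-- The potential `settled + 3 * openDisagree` does not increase on average. -/
theorem sum_settled_step (h : PivotLabels L) :
    ∑ u, (settled G (pivotStep G L u) + 3 * openDisagree G cl (pivotStep G L u)) ≤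
      n * (settled G L + 3 * openDisagree G cl L) := by
  classical
  have h1 : ∑ u, settled G (pivotStep G L u) = n * settled G L +
      ∑ u, ∑ x, ∑ y, (if n ≤ L u ∧ n ≤ L x ∧ n ≤ L y ∧ BadTriple G u x y then 1 else 0) := by
    have : n * settled G L = ∑ _u : Fin n, settled G L := by simp
    rw [this, ← Finset.sum_add_distrib]
    refine Finset.sum_congr rfl fun u _ => ?_
    unfold settled
    simp only [← Finset.sum_add_distrib]
    refine Finset.sum_congr rfl fun x _ => Finset.sum_congr rfl fun y _ => ?_
    simp only [settled_pair_step G h]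
    by_cases hxy : n ≤ L x ∧ n ≤ L y
    · simp [hxy]
    · have : ¬ (n ≤ L u ∧ n ≤ L x ∧ n ≤ L y ∧ BadTriple G u x y) := by tauto
      simp [hxy, this]
  have h2 : ∑ u, openDisagree G cl (pivotStep G L u) +
      ∑ u, ∑ x, ∑ y, (if (n ≤ L u ∧ n ≤ L x ∧ n ≤ L y ∧ BadTriple G u x y) ∧
        Disagree G cl x y then 1 else 0) ≤ n * openDisagree G cl L := by
    have : n * openDisagree G cl L = ∑ _u : Fin n, openDisagree G cl L := by simp
    rw [this, ← Finset.sum_add_distrib]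
    refine Finset.sum_le_sum fun u _ => ?_
    unfold openDisagree
    simp only [← Finset.sum_add_distrib]
    refine Finset.sum_le_sum fun x _ => Finset.sum_le_sum fun y _ => ?_
    obtain ⟨h3, h4⟩ := open_pair_step G (L := L) (Disagree G cl x y) u x y
    by_cases h5 : n ≤ pivotStep G L u x ∧ n ≤ pivotStep G L u y ∧ Disagree G cl x y
    · rw [if_pos h5, if_pos (h3 h5), if_neg fun h6 => h4 h5 h6.1]
    · by_cases h6 : (n ≤ L u ∧ n ≤ L x ∧ n ≤ L y ∧ BadTriple G u x y) ∧ Disagree G cl x y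
      · have h7 : n ≤ L x ∧ n ≤ L y ∧ Disagree G cl x y := ⟨h6.1.2.1, h6.1.2.2.1, h6.2⟩
        rw [if_neg h5, if_pos h6, if_pos h7]
      · rw [if_neg h5, if_neg h6]
        exact Nat.zero_le _
  have h3 := sum_badTriple_le G cl (L := L)
  rw [Finset.sum_add_distrib, ← Finset.mul_sum, h1]
  nlinarith

theorem openEdges_step_le (u : Fin n) : openEdges G (pivotStep G L u) ≤ openEdges G L := by
  classical
  unfold openEdges
  refine Finset.sum_le_sum fun x _ => Finset.sum_le_sum fun y _ => ?_
  have h3 := (open_pair_step G (L := L) (G.Adj x y) u x y).1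
  by_cases h5 : n ≤ pivotStep G L u x ∧ n ≤ pivotStep G L u y ∧ G.Adj x y
  · rw [if_pos h5, if_pos (h3 h5)]
  · rw [if_neg h5]
    exact Nat.zero_le _

/-- An unclustered pivot removes its unclustered neighbours. -/
theorem sum_openCount_step :
    ∑ u, openCount (pivotStep G L u) + openEdges G L ≤ n * openCount L := by
  classical
  have : n * openCount L = ∑ _u : Fin n, openCount L := by simp
  rw [this]
  unfold openEdges
  rw [← Finset.sum_add_distrib]
  refine Finset.sum_le_sum fun u _ => ?_
  unfold openCount
  rw [← Finset.sum_add_distrib]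
  refine Finset.sum_le_sum fun x _ => ?_
  have hlt := u.2
  by_cases hu : n ≤ L u
  · simp only [pivotStep, hu, if_true]
    grind
  · simp [pivotStep, hu]

end Pivot

section PivotRounds

theorem exists_cost_eq_opt {n : ℕ} (G : SimpleGraph (Fin n)) : ∃ cl : Fin n → ℕ, cost G cl = opt G :=
  Nat.sInf_mem (Set.range_nonempty (cost G))

theorem div_natCast_le {a : ENNReal} {n b : ℕ} (h : a ≤ n * b) : a / n ≤ b := by
  refine ENNReal.div_le_of_le_mul ?_
  rwa [mul_comm]

variable {n : ℕ} [NeZero n] (G : SimpleGraph (Fin n))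

/-- One round of the pivot algorithm with a uniformly random vertex. -/
noncomputable def pivotRound (L : Fin n → ℕ) : PMF (Fin n → ℕ) :=
  (PMF.uniformOfFintype (Fin n)).map (pivotStep G L)

theorem expect_pivotRound (L : Fin n → ℕ) (f : (Fin n → ℕ) → ENNReal) :
    expect (pivotRound G L) f = (∑ u, f (pivotStep G L u)) / n := by
  rw [pivotRound, expect_map, expect_uniform]

theorem expect_settled_le (cl : Fin n → ℕ) (r : ℕ) : ∀ {L : Fin n → ℕ}, PivotLabels L →
    expect (iterate (pivotRound G) r L) (fun L' => (settled G L' : ENNReal)) ≤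
      ((settled G L + 3 * openDisagree G cl L : ℕ) : ENNReal) := by
  induction r with
  | zero =>
    intro L _
    rw [iterate, expect_pure]
    exact_mod_cast Nat.le_add_right _ _
  | succ r ih =>
    intro L hL
    rw [iterate, expect_bind, expect_pivotRound]
    refine div_natCast_le ((Finset.sum_le_sum fun u _ => ih (hL.step G u)).trans ?_)
    exact_mod_cast sum_settled_step G cl hL

/-- The edges that are left after `r` rounds: each round is expected to remove, in the mean, at
least `openEdges / n` vertices. -/
theorem expect_openEdges_le (r : ℕ) : ∀ L : Fin n → ℕ,
    r * expect (iterate (pivotRound G) r L) (fun L' => (openEdges G L' : ENNReal)) ≤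
      n * (openCount L : ENNReal) := by
  have hmono : ∀ r, ∀ L : Fin n → ℕ, expect (iterate (pivotRound G) r L)
      (fun L' => (openEdges G L' : ENNReal)) ≤ openEdges G L := by
    intro r
    induction r with
    | zero => intro L; rw [iterate, expect_pure]
    | succ r ih =>
      intro L
      rw [iterate, expect_bind, expect_pivotRound]
      refine div_natCast_le ((Finset.sum_le_sum fun u _ => (ih _).trans
        (Nat.cast_le.2 (openEdges_step_le G u))).trans ?_)
      simp
  have hn : (n : ENNReal) ≠ 0 := by exact_mod_cast NeZero.ne n
  have hn' : (n : ENNReal) ≠ ⊤ := ENNReal.natCast_ne_top n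
  induction r with
  | zero => intro L; simp
  | succ r ih =>
    intro L
    rw [Nat.cast_succ, add_mul, one_mul]
    refine (add_le_add_right (hmono (r + 1) L) _).trans ?_
    rw [iterate, expect_bind, expect_pivotRound, ← mul_div_assoc, Finset.mul_sum]
    refine (add_le_add_left (ENNReal.div_le_div_right
      (Finset.sum_le_sum fun u _ => ih (pivotStep G L u)) _) _).trans ?_
    rw [← Finset.mul_sum, mul_comm, mul_div_assoc, ENNReal.div_self hn hn', mul_one]
    exact_mod_cast sum_openCount_step G

theorem expect_iterate_pivotRound_mono {f g : (Fin n → ℕ) → ENNReal}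
    (hfg : ∀ L, PivotLabels L → f L ≤ g L) (r : ℕ) : ∀ {L : Fin n → ℕ}, PivotLabels L →
    expect (iterate (pivotRound G) r L) f ≤ expect (iterate (pivotRound G) r L) g := by
  induction r with
  | zero =>
    intro L hL
    simpa only [iterate, expect_pure] using hfg L hL
  | succ r ih =>
    intro L hL
    rw [iterate, expect_bind, expect_pivotRound, expect_bind, expect_pivotRound]
    exact ENNReal.div_le_div_right (Finset.sum_le_sum fun u _ => ih (hL.step G u)) _

/-- The expected cost of the pivot algorithm after `r` rounds is at most `3 * opt + n ^ 2 / (2 * r)`;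
here in terms of ordered pairs. -/
theorem expect_pairCost_le (r : ℕ) :
    r * expect (iterate (pivotRound G) r fun v => n + (v : ℕ))
      (fun L => (pairCost G L : ENNReal)) ≤ ((6 * r * opt G + n ^ 2 : ℕ) : ENNReal) := by
  obtain ⟨cl, hcl⟩ := exists_cost_eq_opt G
  set L₀ : Fin n → ℕ := fun v => n + (v : ℕ)
  have h1 : expect (iterate (pivotRound G) r L₀) (fun L => (pairCost G L : ENNReal)) ≤
      expect (iterate (pivotRound G) r L₀)
        (fun L => (settled G L : ENNReal) + (openEdges G L : ENNReal)) := by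
    refine expect_iterate_pivotRound_mono G (fun L hL => ?_) r pivotLabels_init
    rw [pairCost_eq_settled_add G hL, Nat.cast_add]
  have h2 : settled G L₀ = 0 := by
    simp [settled, L₀]
  have h3 : openDisagree G cl L₀ ≤ 2 * opt G := by
    rw [← hcl, ← pairCost_eq]
    refine Finset.sum_le_sum fun x _ => Finset.sum_le_sum fun y _ => ?_
    by_cases hd : Disagree G cl x y
    · rw [if_pos hd]
      split_ifs <;> omega
    · rw [if_neg hd, if_neg fun h => hd h.2.2]
  have h4 : openCount L₀ = n := by
    simp [openCount, L₀]
  have h5 := expect_settled_le G cl r (L := L₀) pivotLabels_init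
  have h6 := expect_openEdges_le G r L₀
  rw [h2, zero_add] at h5
  rw [h4] at h6
  calc _ ≤ (r : ENNReal) * (((3 * (2 * opt G) : ℕ) : ENNReal) +
        expect (iterate (pivotRound G) r L₀) fun L => (openEdges G L : ENNReal)) := by
        refine mul_le_mul_right (h1.trans ?_) _
        rw [expect_add]
        refine add_le_add_left (h5.trans ?_) _
        exact_mod_cast Nat.mul_le_mul_left 3 h3
    _ ≤ (r : ENNReal) * ((3 * (2 * opt G) : ℕ) : ENNReal) + n * n := by
        rw [mul_add]
        exact add_le_add_right h6 _
    _ = _ := by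
        push_cast
        ring

end PivotRounds

/-! ### Estimating costs by sampling, and the best of several runs -/

section Sampling

variable {n : ℕ} [NeZero n] (G : SimpleGraph (Fin n)) (L : Fin n → ℕ)

open Classical in
/-- Draw an ordered pair of vertices and count it if it is a disagreement of `L`. -/
noncomputable def sampleRound (c : ℕ) : PMF ℕ :=
  (PMF.uniformOfFintype (Fin n)).bind fun x =>
    (PMF.uniformOfFintype (Fin n)).map fun y => c + if Disagree G L x y then 1 else 0

omit [NeZero n] in
theorem pairCost_le : pairCost G L ≤ n ^ 2 := by
  classical
  calc pairCost G L ≤ ∑ _x : Fin n, ∑ _y : Fin n, 1 :=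
        Finset.sum_le_sum fun x _ => Finset.sum_le_sum fun y _ => by split_ifs <;> simp
    _ = n ^ 2 := by simp [sq]

theorem expect_sampleRound_le (θ : ℝ) (c : ℕ) :
    expect (sampleRound G L c) (fun Y => ENNReal.ofReal (Real.exp (θ * Y))) ≤
      ENNReal.ofReal (Real.exp ((Real.exp θ - 1) * (pairCost G L / n ^ 2))) *
        ENNReal.ofReal (Real.exp (θ * c)) := by
  classical
  have hn : (0 : ℝ) < n := by exact_mod_cast Nat.pos_of_ne_zero (NeZero.ne n)
  have hn2 : ENNReal.ofReal n = (n : ENNReal) := by simp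
  have hsum : ∑ x, ∑ y, Real.exp (θ * ((c + if Disagree G L x y then 1 else 0 : ℕ) : ℝ)) =
      Real.exp (θ * c) * ((n : ℝ) ^ 2 + (Real.exp θ - 1) * pairCost G L) := by
    have h1 : ∀ x y, Real.exp (θ * ((c + if Disagree G L x y then 1 else 0 : ℕ) : ℝ)) =
        Real.exp (θ * c) * (1 + (Real.exp θ - 1) * ((if Disagree G L x y then 1 else 0 : ℕ) : ℝ)) := by
      intro x y
      split_ifs
      · push_cast
        rw [mul_add, Real.exp_add, mul_one]
        ring
      · simp
    simp only [h1, ← Finset.mul_sum, Finset.sum_add_distrib]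
    simp only [Finset.sum_const, Finset.card_univ, Fintype.card_fin, nsmul_eq_mul,
      mul_one, pairCost]
    push_cast
    ring
  rw [sampleRound, expect_bind, expect_uniform]
  simp only [expect_map, expect_uniform]
  rw [← ENNReal.ofReal_mul (Real.exp_pos _).le]
  have h2 : ∀ x, (∑ y, ENNReal.ofReal (Real.exp
      (θ * ((c + if Disagree G L x y then 1 else 0 : ℕ) : ℝ)))) / (n : ENNReal) =
      ENNReal.ofReal ((∑ y, Real.exp
        (θ * ((c + if Disagree G L x y then 1 else 0 : ℕ) : ℝ))) / n) := by
    intro x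
    rw [ENNReal.ofReal_div_of_pos hn, hn2,
      ENNReal.ofReal_sum_of_nonneg fun y _ => (Real.exp_pos _).le]
  simp only [h2]
  rw [← ENNReal.ofReal_sum_of_nonneg (fun x _ => div_nonneg
    (Finset.sum_nonneg fun y _ => (Real.exp_pos _).le) hn.le), ← hn2,
    ← ENNReal.ofReal_div_of_pos hn, ← Finset.sum_div, hsum]
  refine ENNReal.ofReal_le_ofReal ?_
  rw [mul_comm (Real.exp _) (Real.exp (θ * c)), mul_div_assoc, mul_div_assoc]
  refine mul_le_mul_of_nonneg_left ?_ (Real.exp_pos _).le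
  have h3 := Real.add_one_le_exp ((Real.exp θ - 1) * (pairCost G L / (n : ℝ) ^ 2))
  refine le_trans (le_of_eq ?_) h3
  field_simp
  ring

/-- The exponential moments of the number of sampled disagreements. -/
theorem expect_sample_le (θ : ℝ) (m : ℕ) : ∀ c : ℕ,
    expect (iterate (sampleRound G L) m c) (fun Y => ENNReal.ofReal (Real.exp (θ * Y))) ≤
      ENNReal.ofReal (Real.exp (m * ((Real.exp θ - 1) * (pairCost G L / n ^ 2)))) *
        ENNReal.ofReal (Real.exp (θ * c)) := by
  induction m with
  | zero => intro c; simp [iterate]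
  | succ m ih =>
    intro c
    rw [iterate, expect_bind]
    refine (expect_mono _ ih).trans ?_
    rw [expect_mul_left]
    refine (mul_le_mul_right (expect_sampleRound_le G L θ c) _).trans (le_of_eq ?_)
    rw [← mul_assoc, ← ENNReal.ofReal_mul (Real.exp_pos _).le, ← Real.exp_add]
    congr 3
    push_cast
    ring

open Classical in
/-- Chernoff bound; for `θ > 0` it bounds the upper and for `θ < 0` the lower tail. -/
theorem expect_tail_le (θ t : ℝ) (m : ℕ) (p : ℕ → Prop) (hp : ∀ Y : ℕ, p Y → θ * t ≤ θ * Y) :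
    expect (iterate (sampleRound G L) m 0) (fun Y => if p Y then 1 else 0) ≤
      ENNReal.ofReal
        (Real.exp (m * ((Real.exp θ - 1) * (pairCost G L / n ^ 2)) - θ * t)) := by
  have h : ∀ Y : ℕ, (if p Y then (1 : ENNReal) else 0) ≤
      ENNReal.ofReal (Real.exp (-(θ * t))) * ENNReal.ofReal (Real.exp (θ * Y)) := by
    intro Y
    split_ifs with hY
    · rw [← ENNReal.ofReal_mul (Real.exp_pos _).le, ← Real.exp_add, ← ENNReal.ofReal_one]
      refine ENNReal.ofReal_le_ofReal (Real.one_le_exp ?_)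
      linarith [hp Y hY]
    · exact zero_le
  refine (expect_mono _ h).trans ?_
  rw [expect_mul_left]
  refine (mul_le_mul_right (expect_sample_le G L θ m 0) _).trans (le_of_eq ?_)
  simp only [Nat.cast_zero, mul_zero, Real.exp_zero, ENNReal.ofReal_one, mul_one]
  rw [← ENNReal.ofReal_mul (Real.exp_pos _).le, ← Real.exp_add]
  congr 2
  ring

omit [NeZero n] in
theorem ofReal_exp_le {x : ℝ} (hx : x ≤ -1000) : ENNReal.ofReal (Real.exp x) ≤ 1 / 1000 := by
  have h1 := Real.add_one_le_exp (-x)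
  rw [Real.exp_neg] at h1
  have h2 : Real.exp x ≤ 1 / 1000 := by
    rw [← inv_inv (Real.exp x), one_div]
    exact inv_anti₀ (by norm_num) (by linarith)
  refine (ENNReal.ofReal_le_ofReal h2).trans (le_of_eq ?_)
  rw [ENNReal.ofReal_div_of_pos (by norm_num)]
  simp

open Classical in
/-- If the expected count is at most `7 / 8 * β`, then the count rarely exceeds `15 / 16 * β`. -/
theorem expect_upper_tail_le {m : ℕ} {β : ℝ} (hβ : 1024000 ≤ β)
    (h : m * (pairCost G L / (n : ℝ) ^ 2) ≤ 7 / 8 * β) :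
    expect (iterate (sampleRound G L) m 0) (fun Y => if 15 / 16 * β < (Y : ℝ) then 1 else 0) ≤
      1 / 1000 := by
  -- `θ = 1 / 32`: the exponent is at most `(θ + θ ^ 2) * 7 / 8 * β - θ * 15 / 16 * β < -β / 1024`.
  refine (expect_tail_le G L (1 / 32) (15 / 16 * β) m _ (fun Y hY => by linarith)).trans
    (ofReal_exp_le ?_)
  have h1 := (abs_le.1 (Real.abs_exp_sub_one_sub_id_le (x := 1 / 32) (by norm_num [abs_le]))).2
  set μ := m * (pairCost G L / (n : ℝ) ^ 2) with hμ
  have h0 : 0 ≤ μ := by positivity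
  have h2 : (Real.exp (1 / 32) - 1) * μ ≤ (1 / 32 + (1 / 32) ^ 2) * μ :=
    mul_le_mul_of_nonneg_right (by linarith) h0
  have h3 : m * ((Real.exp (1 / 32) - 1) * (pairCost G L / (n : ℝ) ^ 2)) =
      (Real.exp (1 / 32) - 1) * μ := by rw [hμ]; ring
  rw [h3]
  linarith

open Classical in
/-- If the expected count is at least `β`, then the count is rarely below `15 / 16 * β`. -/
theorem expect_lower_tail_le {m : ℕ} {β : ℝ} (hβ : 1024000 ≤ β)
    (h : β ≤ m * (pairCost G L / (n : ℝ) ^ 2)) :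
    expect (iterate (sampleRound G L) m 0) (fun Y => if (Y : ℝ) ≤ 15 / 16 * β then 1 else 0) ≤
      1 / 1000 := by
  -- `θ = -1 / 32`: the exponent is at most `(θ + θ ^ 2) * β - θ * 15 / 16 * β = -β / 1024`.
  refine (expect_tail_le G L (-(1 / 32)) (15 / 16 * β) m _ (fun Y hY => by linarith)).trans
    (ofReal_exp_le ?_)
  have h1 := (abs_le.1 (Real.abs_exp_sub_one_sub_id_le (x := -(1 / 32))
    (by norm_num [abs_le]))).2
  set μ := m * (pairCost G L / (n : ℝ) ^ 2) with hμ
  have h0 : 0 ≤ μ := by positivity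
  have h2 : (Real.exp (-(1 / 32)) - 1) * μ ≤ (-(1 / 32) + (1 / 32) ^ 2) * μ :=
    mul_le_mul_of_nonneg_right (by linarith) h0
  have h3 : m * ((Real.exp (-(1 / 32)) - 1) * (pairCost G L / (n : ℝ) ^ 2)) =
      (Real.exp (-(1 / 32)) - 1) * μ := by rw [hμ]; ring
  rw [h3]
  linarith

/-- A run of the pivot algorithm with `N` rounds, together with the number of disagreements among
`m` sampled pairs. -/
noncomputable def candidate (N m : ℕ) : PMF ((Fin n → ℕ) × ℕ) :=
  (iterate (pivotRound G) N fun v => n + (v : ℕ)).bind fun L =>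
    (iterate (sampleRound G L) m 0).map fun c => (L, c)

/-- Replace the best clustering so far by a new candidate if that has fewer sampled
disagreements. -/
noncomputable def improve (N m : ℕ) (b : (Fin n → ℕ) × ℕ) : PMF ((Fin n → ℕ) × ℕ) :=
  (candidate G N m).map fun a => if a.2 < b.2 then a else b

open Classical in
/-- By Markov's inequality, a run of the pivot algorithm has a cost close to its mean with
probability at least `1 / 7`. -/
theorem expect_pairCost_large_le {N : ℕ} :
    expect (iterate (pivotRound G) N fun v => n + (v : ℕ))
      (fun L => if 7 * (6 * N * opt G + n ^ 2) ≤ 6 * N * pairCost G L then 1 else 0) ≤ 6 / 7 := by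
  have h1 := expect_pairCost_le G N
  set Q := 6 * N * opt G + n ^ 2 with hQ
  have hn := Nat.pos_of_ne_zero (NeZero.ne n)
  have hQ0 : Q ≠ 0 := by positivity
  set μ := iterate (pivotRound G) N fun v => n + (v : ℕ)
  have h2 : ((7 * Q : ℕ) : ENNReal) * expect μ
      (fun L => if 7 * Q ≤ 6 * N * pairCost G L then 1 else 0) ≤ ((6 * Q : ℕ) : ENNReal) := by
    rw [← expect_mul_left]
    calc _ ≤ expect μ fun L => ((6 * N : ℕ) : ENNReal) * (pairCost G L : ENNReal) := by
          refine expect_mono _ fun L => ?_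
          split_ifs with h
          · rw [mul_one]
            exact_mod_cast h
          · simp
      _ = 6 * (N * expect μ fun L => (pairCost G L : ENNReal)) := by
          rw [expect_mul_left]
          push_cast
          ring
      _ ≤ _ := by
          push_cast
          exact mul_le_mul_right h1 _
  have h3 : (Q : ENNReal) ≠ 0 := by exact_mod_cast hQ0
  have h4 : (Q : ENNReal) ≠ ⊤ := ENNReal.natCast_ne_top Q
  rw [ENNReal.le_div_iff_mul_le (by simp) (by simp)]
  refine (ENNReal.mul_le_mul_iff_right h3 h4).1 ?_
  calc _ = _ := by push_cast; ring
    _ ≤ _ := h2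
    _ = _ := by push_cast; ring

/-- The cost of `L` exceeds `4 * opt + n ^ 2 / N`. -/
def Costly (N : ℕ) (L : Fin n → ℕ) : Prop :=
  8 * N * opt G + 2 * n ^ 2 < N * pairCost G L

variable (N m : ℕ) (β : ℝ)

open Classical in
/-- A candidate has a small count with probability at least `1 / 8`. Here `β` is the expected count
of a clustering of cost `4 * opt + n ^ 2 / N`. -/
theorem expect_candidate_large_le (hN : 1 ≤ N) (hβ : 1024000 ≤ β)
    (hβ' : β * (N * (n : ℝ) ^ 2) = m * (8 * N * opt G + 2 * (n : ℝ) ^ 2)) :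
    expect (candidate G N m) (fun a => if 15 / 16 * β < (a.2 : ℝ) then 1 else 0) ≤ 7 / 8 := by
  have hn : (0 : ℝ) < n := by exact_mod_cast Nat.pos_of_ne_zero (NeZero.ne n)
  have hN' : (0 : ℝ) < N := by exact_mod_cast hN
  rw [candidate, expect_bind]
  simp only [expect_map]
  have h1 : ∀ L : Fin n → ℕ, expect (iterate (sampleRound G L) m 0)
      (fun Y => if 15 / 16 * β < (Y : ℝ) then 1 else 0) ≤
      (if 7 * (6 * N * opt G + n ^ 2) ≤ 6 * N * pairCost G L then 1 else 0) + 1 / 1000 := by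
    intro L
    split_ifs with h
    · refine (expect_le_of_le _ (c := 1) fun Y => ?_).trans le_self_add
      split_ifs <;> simp
    · rw [zero_add]
      refine expect_upper_tail_le G L hβ ?_
      have h' : (6 * N * pairCost G L : ℝ) < 7 * (6 * N * opt G + (n : ℝ) ^ 2) := by
        exact_mod_cast not_le.1 h
      have hm : (0 : ℝ) ≤ m := by positivity
      rw [← mul_div_assoc, div_le_iff₀ (by positivity)]
      refine le_of_mul_le_mul_left ?_ hN'
      have h2 : (N : ℝ) * (7 / 8 * β * (n : ℝ) ^ 2) =
          7 / 8 * (m * (8 * N * opt G + 2 * (n : ℝ) ^ 2)) := by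
        rw [← hβ']; ring
      rw [h2]
      have h3 : (N * pairCost G L : ℝ) ≤ 7 / 8 * (8 * N * opt G + 2 * (n : ℝ) ^ 2) := by
        nlinarith
      nlinarith
  refine (expect_mono _ h1).trans ?_
  rw [expect_add, expect_const]
  refine (add_le_add_left (expect_pairCost_large_le G) _).trans ?_
  rw [← ENNReal.toReal_le_toReal (by finiteness) (by finiteness)]
  rw [ENNReal.toReal_add (by finiteness) (by finiteness)]
  norm_num

open Classical in
/-- A candidate is rarely deceptive, that is, costly but with a small count. -/
theorem expect_candidate_deceptive_le (hN : 1 ≤ N) (hβ : 1024000 ≤ β)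
    (hβ' : β * (N * (n : ℝ) ^ 2) = m * (8 * N * opt G + 2 * (n : ℝ) ^ 2)) :
    expect (candidate G N m) (fun a => if Costly G N a.1 ∧
      (a.2 : ℝ) ≤ 15 / 16 * β then 1 else 0) ≤ 1 / 1000 := by
  have hn : (0 : ℝ) < n := by exact_mod_cast Nat.pos_of_ne_zero (NeZero.ne n)
  have hN' : (0 : ℝ) < N := by exact_mod_cast hN
  rw [candidate, expect_bind]
  simp only [expect_map]
  refine expect_le_of_le _ fun L => ?_
  by_cases h : Costly G N L
  · simp only [h, true_and]
    refine expect_lower_tail_le G L hβ ?_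
    have h' : (8 * N * opt G + 2 * (n : ℝ) ^ 2) < N * pairCost G L := by exact_mod_cast h
    rw [← mul_div_assoc, le_div_iff₀ (by positivity)]
    refine le_of_mul_le_mul_left ?_ hN'
    have h2 : (N : ℝ) * (β * (n : ℝ) ^ 2) = m * (8 * N * opt G + 2 * (n : ℝ) ^ 2) := by
      rw [← hβ']; ring
    rw [h2]
    have hm : (0 : ℝ) ≤ m := by positivity
    nlinarith
  · simp [h, expect_const]

open Classical in
/-- The best count stays large only if the counts of all candidates are large. -/
theorem expect_improve_large_le (t : ℝ)
    (h : expect (candidate G N m) (fun a => if t < (a.2 : ℝ) then 1 else 0) ≤ 7 / 8) (i : ℕ) :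
    ∀ b : (Fin n → ℕ) × ℕ,
    expect (iterate (improve G N m) i b) (fun a => if t < (a.2 : ℝ) then 1 else 0) ≤
      (7 / 8) ^ i * if t < (b.2 : ℝ) then 1 else 0 := by
  induction i with
  | zero => intro b; simp [iterate]
  | succ i ih =>
    intro b
    rw [iterate, expect_bind]
    refine (expect_mono _ ih).trans ?_
    rw [expect_mul_left, pow_succ, mul_assoc]
    refine mul_le_mul_right ?_ _
    rw [improve, expect_map]
    by_cases hb : t < (b.2 : ℝ)
    · rw [if_pos hb, mul_one]
      refine (expect_mono _ fun a => ?_).trans h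
      by_cases ha : t < (a.2 : ℝ)
      · rw [if_pos ha]
        split_ifs <;> simp
      · have hab : a.2 < b.2 := by exact_mod_cast (not_lt.1 ha).trans_lt hb
        simp [hab]
    · rw [if_neg hb, mul_zero]
      refine expect_le_of_le _ fun a => ?_
      by_cases hab : a.2 < b.2
      · have : ¬ t < (a.2 : ℝ) := by
          have : (a.2 : ℝ) < b.2 := by exact_mod_cast hab
          linarith
        simp [hab, this]
      · simp [hab, hb]

open Classical in
/-- A bad clustering with a small count must have entered with some candidate. -/
theorem expect_improve_deceptive_le (t : ℝ) (bad : (Fin n → ℕ) → Prop)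
    (h : expect (candidate G N m) (fun a => if bad a.1 ∧ (a.2 : ℝ) ≤ t then 1 else 0) ≤ 1 / 1000)
    (i : ℕ) : ∀ b : (Fin n → ℕ) × ℕ,
    expect (iterate (improve G N m) i b) (fun a => if bad a.1 ∧ (a.2 : ℝ) ≤ t then 1 else 0) ≤
      (if bad b.1 ∧ (b.2 : ℝ) ≤ t then 1 else 0) + i * (1 / 1000) := by
  induction i with
  | zero => intro b; simp [iterate]
  | succ i ih =>
    intro b
    rw [iterate, expect_bind]
    refine (expect_mono _ ih).trans ?_
    rw [expect_add, expect_const, Nat.cast_succ, add_mul, one_mul, add_comm ((i : ENNReal) * _),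
      ← add_assoc]
    refine add_le_add_left ?_ _
    rw [improve, expect_map]
    calc _ ≤ expect (candidate G N m) fun a => (if bad b.1 ∧ (b.2 : ℝ) ≤ t then (1 : ENNReal) else 0) +
          (if bad a.1 ∧ (a.2 : ℝ) ≤ t then 1 else 0) := by
          refine expect_mono _ fun a => ?_
          by_cases hab : a.2 < b.2
          · simp [hab]
          · simp [hab]
      _ ≤ _ := by
          rw [expect_add, expect_const]
          exact add_le_add_right h _

open Classical in
/-- The best of 16 runs is good enough with probability at least `2 / 3`. The number `2 ^ 20 * N` of
samples per run makes the errors of the estimates negligible. -/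
theorem expect_best_bad_le (hN : 1 ≤ N) :
    expect (iterate (improve G N (2 ^ 20 * N)) 16 (fun _ => 0, 2 ^ 20 * N + 1))
      (fun a => if Costly G N a.1 then 1 else 0) ≤ 1 / 3 := by
  have hn : (0 : ℝ) < n := by exact_mod_cast Nat.pos_of_ne_zero (NeZero.ne n)
  have hN' : (0 : ℝ) < N := by exact_mod_cast hN
  by_cases hbad : ∃ L, Costly G N L
  swap
  · push Not at hbad
    refine (expect_le_of_le _ (c := 0) fun a => ?_).trans zero_le
    simp [hbad a.1]
  obtain ⟨L, hL⟩ := hbad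
  set m := 2 ^ 20 * N with hm
  set β : ℝ := m * (8 * N * opt G + 2 * (n : ℝ) ^ 2) / (N * (n : ℝ) ^ 2) with hβdef
  have hβ' : β * (N * (n : ℝ) ^ 2) = m * (8 * N * opt G + 2 * (n : ℝ) ^ 2) := by
    rw [hβdef]
    field_simp
  have hmr : (m : ℝ) = 2 ^ 20 * N := by rw [hm]; push_cast; ring
  have hβ : 1024000 ≤ β := by
    rw [hβdef, le_div_iff₀ (by positivity), hmr]
    have h1 : 2 * (n : ℝ) ^ 2 ≤ 8 * N * opt G + 2 * (n : ℝ) ^ 2 := by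
      have : (0 : ℝ) ≤ 8 * N * opt G := by positivity
      linarith
    calc 1024000 * (N * (n : ℝ) ^ 2) ≤ 2 ^ 20 * N * (2 * (n : ℝ) ^ 2) := by
          nlinarith [mul_pos hN' (pow_pos hn 2)]
      _ ≤ _ := mul_le_mul_of_nonneg_left h1 (by positivity)
  -- A bad clustering exists, so that the threshold cannot exceed the number of samples.
  have hβm : 15 / 16 * β < ((m + 1 : ℕ) : ℝ) := by
    have h1 : (8 * N * opt G + 2 * (n : ℝ) ^ 2) < N * (n : ℝ) ^ 2 := by
      have : 8 * N * opt G + 2 * n ^ 2 < N * n ^ 2 :=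
        lt_of_lt_of_le hL (Nat.mul_le_mul_left N (pairCost_le G L))
      exact_mod_cast this
    have h2 : β ≤ m := by
      rw [hβdef, div_le_iff₀ (by positivity)]
      exact mul_le_mul_of_nonneg_left h1.le (by positivity)
    push_cast
    linarith
  have h1 := expect_improve_large_le G N m _ (expect_candidate_large_le G N m β hN hβ hβ') 16
    (fun _ => 0, m + 1)
  have h2 := expect_improve_deceptive_le G N m _ (Costly G N)
    (expect_candidate_deceptive_le G N m β hN hβ hβ') 16 (fun _ => 0, m + 1)
  rw [if_neg fun h => absurd h.2 (not_le.2 hβm), zero_add] at h2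
  rw [if_pos hβm, mul_one] at h1
  calc _ ≤ expect (iterate (improve G N m) 16 (fun _ => 0, m + 1)) fun a =>
        (if 15 / 16 * β < (a.2 : ℝ) then 1 else 0) +
        (if Costly G N a.1 ∧ (a.2 : ℝ) ≤ 15 / 16 * β then 1 else 0) := by
        refine expect_mono _ fun a => ?_
        by_cases h3 : 15 / 16 * β < (a.2 : ℝ)
        · rw [if_pos h3]
          refine le_trans ?_ le_self_add
          split_ifs <;> simp
        · simp [h3, not_lt.1 h3]
    _ ≤ (7 / 8) ^ 16 + ((16 : ℕ) : ENNReal) * (1 / 1000) := by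
        rw [expect_add]
        exact add_le_add h1 h2
    _ ≤ 1 / 3 := by
        rw [← ENNReal.toReal_le_toReal (by finiteness) (by finiteness)]
        rw [ENNReal.toReal_add (by finiteness) (by finiteness)]
        norm_num

end Sampling

/-! ### The program -/

section Program

/-
Registers: `0`, `1` hold `n`, `N`; `2` counts the remaining candidates; `3` is the count of the best
clustering so far; `4` counts the remaining rounds or samples; `5` and `6` are vertices; `7` is the
count of the current candidate; `8`, `9`, `10` hold the constants `1`, `2 ^ 20 * N`, `0`; the others
are temporary.
-/

local infixr:60 " ;; " => Prog.seq

/-- A program without effect on the registers that are in use. -/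
def skip : Prog := .set 13 0

/-- Give the vertex `v` the label `n + v`, for `v` the predecessor of register `5`. -/
def initBody : Prog :=
  .op .sub 5 5 8 ;; .op .add 11 0 5 ;; .store 11 11

/-- Move the vertex `v` to the cluster of the pivot in register `6` if it is unclustered and it is
the pivot or a neighbour of it, for `v` the predecessor of register `5`. -/
def assignBody : Prog :=
  .op .sub 5 5 8 ;; .op .add 11 0 5 ;; .load 12 11 ;; .op .lt 13 12 0 ;;
    .ite 13 skip (.query 13 6 5 ;; .op .eq 12 6 5 ;; .op .add 13 13 12 ;;
      .ite 13 (.store 11 6) skip)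

/-- One round of the pivot algorithm. -/
def roundBody : Prog :=
  .op .sub 4 4 8 ;; .rand 6 0 ;; .op .add 11 0 6 ;; .load 12 11 ;; .op .lt 13 12 0 ;;
    .ite 13 skip (.op .add 5 0 10 ;; .loop 5 assignBody)

/-- Sample an ordered pair of vertices; register `7` counts the disagreements. -/
def sampleBody : Prog :=
  .op .sub 4 4 8 ;; .rand 5 0 ;; .rand 6 0 ;; .op .add 11 0 5 ;; .load 11 11 ;;
    .op .add 12 0 6 ;; .load 12 12 ;; .op .eq 11 11 12 ;; .query 12 5 6 ;; .op .eq 13 5 6 ;;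
    .op .add 12 12 13 ;; .op .eq 11 11 12 ;; .op .add 7 7 8 ;; .op .sub 7 7 11

/-- Copy the label of the predecessor of register `5` from the working area to the output area. -/
def copyBody : Prog :=
  .op .sub 5 5 8 ;; .op .add 11 0 5 ;; .load 12 11 ;; .store 5 12

/-- Make all vertices of the working area unclustered. -/
def initPart : Prog := .op .add 5 0 10 ;; .loop 5 initBody

/-- `N` rounds of the pivot algorithm. -/
def roundPart : Prog := .op .add 4 1 10 ;; .loop 4 roundBody

/-- Estimate the cost of the candidate in register `7`. -/
def samplePart : Prog := .op .add 4 9 10 ;; .set 7 0 ;; .loop 4 sampleBody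

/-- Make the candidate the best clustering if its count in register `7` is smaller than that in
register `3`. -/
def comparePart : Prog :=
  .op .lt 13 7 3 ;; .ite 13 (.op .add 3 7 10 ;; .op .add 5 0 10 ;; .loop 5 copyBody) skip

/-- Compute a candidate and compare it with the best clustering so far. -/
def candidateBody : Prog :=
  .op .sub 2 2 8 ;; initPart ;; roundPart ;; samplePart ;; comparePart

/-- The program of the upper bound: the best of 16 runs of the pivot algorithm with `N` rounds,
where the costs are compared by means of `2 ^ 20 * N` samples per run. The output area consists
of the memory cells below `n`, the working area of the next `n` cells. -/
def clusterProg : Prog :=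
  .set 8 1 ;; .set 2 16 ;; .set 9 (2 ^ 20) ;; .op .mul 9 9 1 ;; .op .add 3 9 8 ;;
    .loop 2 candidateBody

theorem reg_setReg (w : ℕ) (s : Store) (d v i : ℕ) :
    (s.setReg w d v).reg i = if i = d then v % 2 ^ w else s.reg i :=
  Function.update_apply ..

theorem mem_setReg (w : ℕ) (s : Store) (d v : ℕ) : (s.setReg w d v).mem = s.mem := rfl

theorem reg_setMem (s : Store) (i v : ℕ) : (s.setMem i v).reg = s.reg := rfl

theorem mem_setMem (s : Store) (i v j : ℕ) :
    (s.setMem i v).mem j = if j = i then v else s.mem j :=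
  Function.update_apply ..

/-- The registers that keep their values during the computation of a candidate, and the output
area: `c` further candidates remain, and the best clustering so far is `L` with count `b`. -/
structure Frame (n N c b : ℕ) (L : Fin n → ℕ) (s : Store) : Prop where
  r0 : s.reg 0 = n
  r1 : s.reg 1 = N
  r2 : s.reg 2 = c
  r3 : s.reg 3 = b
  r8 : s.reg 8 = 1
  r9 : s.reg 9 = 2 ^ 20 * N
  r10 : s.reg 10 = 0
  out : ∀ v : Fin n, s.mem v = L v

variable {n N w : ℕ} {G : SimpleGraph (Fin n)}

theorem oracle_fin (G : SimpleGraph (Fin n)) (x y : Fin n) [Decidable (G.Adj x y)] :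
    oracle G x y = if G.Adj x y then 1 else 0 := by
  unfold oracle
  congr 1
  simp

-- The hypothesis `hw` says that no overflow occurs below `2 ^ 22 * (n * N)`.
variable (hw : ∀ x, x ≤ 2 ^ 22 * (n * N) → x % 2 ^ w = x) (hN : 1 ≤ N) {c b : ℕ} {L₀ : Fin n → ℕ}

include hw hN

theorem sim_initPart {s : Store} (h : Frame n N c b L₀ s) :
    Sim w G initPart (6 * n + 3) s (PMF.pure ()) fun _ s' =>
      Frame n N c b L₀ s' ∧ ∀ v : Fin n, s'.mem (n + v) = n + v := by
  have hnN : n ≤ n * N := Nat.le_mul_of_pos_right n hN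
  have hn : n % 2 ^ w = n := hw _ (by omega)
  let I : ℕ → Store → Prop := fun j s => Frame n N c b L₀ s ∧ s.reg 5 = j ∧ j ≤ n ∧
    ∀ v : Fin n, j ≤ v → s.mem (n + v) = n + v
  have hbody : ∀ j s, I (j + 1) s → Sim w G initBody 5 s (PMF.pure ()) fun _ => I j := by
    rintro j s ⟨h, h5, hj, hm⟩ k φ T f hf T' hT'
    obtain ⟨T'', rfl⟩ : ∃ T'', T' = T'' + 5 := ⟨T' - 5, by omega⟩
    have hj1 : j % 2 ^ w = j := hw _ (by omega)
    have hj2 : (n + j) % 2 ^ w = n + j := hw _ (by omega)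
    rw [expect_pure]
    simp only [initBody, value_seq, value_op, value_store]
    refine hf _ (by omega) () _ ⟨⟨?_, ?_, ?_, ?_, ?_, ?_, ?_, ?_⟩, ?_, ?_, ?_⟩
    all_goals try simp [reg_setReg, mem_setReg, reg_setMem, mem_setMem, Op.eval, h.r0, h.r1, h.r2,
      h.r3, h.r8, h.r9, h.r10, h5, hj1, hj2]
    · intro v
      have := v.2
      rw [if_neg (by omega), h.out]
    · omega
    · intro v hv
      by_cases hne : (v : ℕ) = j
      · rw [if_pos hne, hne]
      · rw [if_neg hne, hm v (by omega)]
  intro k φ T f hf T' hT'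
  obtain ⟨T'', rfl⟩ : ∃ T'', T' = T'' + 2 := ⟨T' - 2, by omega⟩
  simp only [initPart, value_seq, value_op]
  refine Sim.loop_pure I (fun s h => h.2.1) (fun i s h => by rw [h.2.1]; omega) hbody n ?_ k φ T f
    (fun T₁ h₁ _ s' hs' => hf T₁ h₁ _ s' ⟨hs'.1, fun v => hs'.2.2.2 v (Nat.zero_le _)⟩) T''
    (by omega)
  refine ⟨⟨?_, ?_, ?_, ?_, ?_, ?_, ?_, ?_⟩, ?_, le_rfl, fun v hv => absurd v.2 (not_lt.2 hv)⟩
  all_goals simp [reg_setReg, mem_setReg, Op.eval, h.r0, h.r1, h.r2, h.r3, h.r8, h.r9, h.r10, h.out,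
    hn]

theorem sim_roundBody [NeZero n] {s : Store} {L : Fin n → ℕ} {i : ℕ} (h : Frame n N c b L₀ s)
    (h4 : s.reg 4 = i + 1) (hi : i + 1 ≤ N) (hL : PivotLabels L)
    (hm : ∀ v : Fin n, s.mem (n + v) = L v) :
    Sim w G roundBody (18 * n + 14) s (pivotRound G L) fun L' s' =>
      Frame n N c b L₀ s' ∧ s'.reg 4 = i ∧ i ≤ N ∧ PivotLabels L' ∧
        ∀ v : Fin n, s'.mem (n + v) = L' v := by
  classical
  have hnN : n ≤ n * N := Nat.le_mul_of_pos_right n hN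
  have hNn : N ≤ n * N := Nat.le_mul_of_pos_left N (Nat.pos_of_ne_zero (NeZero.ne n))
  have hn : n % 2 ^ w = n := hw _ (by omega)
  have h1 : 1 % 2 ^ w = 1 := hw _ (by omega)
  have hi1 : i % 2 ^ w = i := hw _ (by omega)
  intro k φ T f hf T' hT'
  obtain ⟨T'', rfl⟩ : ∃ T'', T' = T'' + 13 := ⟨T' - 13, by omega⟩
  rw [pivotRound, expect_map]
  simp only [roundBody, value_seq, value_op]
  rw [value_rand _ _ _ _ _ _ _ _ (by simp [reg_setReg, h.r0])]
  refine expect_mono _ fun u => ?_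
  have hu := u.2
  have hu1 : (u : ℕ) % 2 ^ w = u := hw _ (by omega)
  have hu2 : (n + (u : ℕ)) % 2 ^ w = n + u := hw _ (by omega)
  have hLu : L u % 2 ^ w = L u := hw _ (by have := hL.lt u; omega)
  simp only [value_seq, value_op, value_load]
  by_cases hun : L u < n
  · rw [value_ite_of_ne _ _ _ _ _ _ _ _ _ (by
      simp [reg_setReg, mem_setReg, Op.eval, h.r0, hu1, hu2, hm, hLu, hun, h1])]
    rw [skip, value_set]
    have hstep : pivotStep G L u = L := by simp [pivotStep, not_le.2 hun]
    rw [hstep]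
    refine hf _ (by omega) _ _ ⟨⟨?_, ?_, ?_, ?_, ?_, ?_, ?_, ?_⟩, ?_, ?_, hL, ?_⟩
    all_goals try simp [reg_setReg, mem_setReg, Op.eval, h.r0, h.r1, h.r2,
      h.r3, h.r8, h.r9, h.r10, h4, h.out, hi1, hm]
    omega
  · rw [value_ite_of_eq _ _ _ _ _ _ _ _ _ (by
      simp [reg_setReg, mem_setReg, Op.eval, h.r0, hu1, hu2, hm, hLu, hun])]
    simp only [value_seq, value_op]
    let I : ℕ → Store → Prop := fun j s => Frame n N c b L₀ s ∧ s.reg 5 = j ∧ j ≤ n ∧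
      s.reg 4 = i ∧ s.reg 6 = u ∧
      ∀ v : Fin n, s.mem (n + v) = if j ≤ v then pivotStep G L u v else L v
    have hbody : ∀ j s, I (j + 1) s → Sim w G assignBody 17 s (PMF.pure ()) fun _ => I j := by
      rintro j s ⟨h, h5, hj, h4, h6, hm⟩ k φ T f hf T' hT'
      obtain ⟨T'', rfl⟩ : ∃ T'', T' = T'' + 17 := ⟨T' - 17, by omega⟩
      have hj1 : j % 2 ^ w = j := hw _ (by omega)
      have hj2 : (n + j) % 2 ^ w = n + j := hw _ (by omega)
      obtain ⟨v, rfl⟩ : ∃ v : Fin n, (v : ℕ) = j := ⟨⟨j, by omega⟩, rfl⟩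
      have hmv : s.mem (n + v) = L v := by rw [hm, if_neg (by omega)]
      have hLv : L v % 2 ^ w = L v := hw _ (by have := hL.lt v; omega)
      have hpost : ∀ v' : Fin n, v' ≠ v → s.mem (n + v') =
          if (v : ℕ) ≤ v' then pivotStep G L u v' else L v' := by
        intro v' hv'
        rw [hm]
        have : (v' : ℕ) ≠ v := fun h => hv' (Fin.ext h)
        by_cases h : (v : ℕ) ≤ v'
        · rw [if_pos h, if_pos (by omega)]
        · rw [if_neg h, if_neg (by omega)]
      rw [expect_pure]
      simp only [assignBody, value_seq, value_op, value_load]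
      by_cases hvn : L v < n
      · rw [value_ite_of_ne _ _ _ _ _ _ _ _ _ (by
          simp [reg_setReg, mem_setReg, Op.eval, h.r0, h.r8, h5, hj1, hj2, hmv, hLv, hvn, h1])]
        rw [skip, value_set]
        have hstep : pivotStep G L u v = L v := by
          have huv : v ≠ u := by rintro rfl; exact hun hvn
          unfold pivotStep
          rw [if_pos (not_lt.1 hun)]
          exact if_neg fun h => h.elim huv fun h => hvn.not_ge h.1
        refine hf _ (by omega) () _ ⟨⟨?_, ?_, ?_, ?_, ?_, ?_, ?_, ?_⟩, ?_, ?_, ?_, ?_, ?_⟩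
        all_goals try simp [reg_setReg, mem_setReg, Op.eval, h.r0, h.r1, h.r2,
          h.r3, h.r8, h.r9, h.r10, h4, h5, h6, h.out, hj1]
        intro v'
        by_cases hv' : v' = v
        · rw [hv', hmv, hstep, ite_self]
        · simpa using hpost v' hv'
      · rw [value_ite_of_eq _ _ _ _ _ _ _ _ _ (by
          simp [reg_setReg, mem_setReg, Op.eval, h.r0, h.r8, h5, hj1, hj2, hmv, hLv, hvn])]
        have ho1 (h : G.Adj u v) : oracle G u v = 1 := by rw [oracle_fin, if_pos h]
        have ho0 (h : ¬ G.Adj u v) : oracle G u v = 0 := by rw [oracle_fin, if_neg h]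
        simp only [value_seq, value_op, value_query]
        by_cases hadj : v = u ∨ G.Adj u v
        · rw [value_ite_of_ne _ _ _ _ _ _ _ _ _ (by
            by_cases huv : u = v
            · subst huv
              simp [reg_setReg, Op.eval, h.r8, h5, h6, hj1, ho0 G.irrefl, h1]
            · have huv' : (u : ℕ) ≠ v := fun h => huv (Fin.ext h)
              have ho := ho1 (hadj.resolve_left fun h => huv h.symm)
              simp [reg_setReg, Op.eval, h.r8, h5, h6, hj1, ho, h1, huv'])]
          rw [value_store]
          have hstep : pivotStep G L u v = u := by
            unfold pivotStep
            rw [if_pos (not_lt.1 hun)]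
            exact if_pos (hadj.imp id fun h => ⟨not_lt.1 hvn, h⟩)
          refine hf _ (by omega) () _ ⟨⟨?_, ?_, ?_, ?_, ?_, ?_, ?_, ?_⟩, ?_, ?_, ?_, ?_, ?_⟩
          all_goals try simp [reg_setReg, mem_setReg, reg_setMem, mem_setMem, Op.eval, h.r0, h.r1,
            h.r2, h.r3, h.r8, h.r9, h.r10, h4, h5, h6, hj1, hj2]
          · intro v'
            have := v'.2
            rw [if_neg (by omega), h.out]
          · intro v'
            by_cases hv' : v' = v
            · simp [hv', hstep]
            · rw [if_neg fun h => hv' (Fin.ext h)]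
              simpa using hpost v' hv'
        · rw [value_ite_of_eq _ _ _ _ _ _ _ _ _ (by
            have huv : (u : ℕ) ≠ v := fun h => hadj (Or.inl (Fin.ext h.symm))
            simp [reg_setReg, Op.eval, h.r8, h5, h6, hj1, ho0 fun h => hadj (Or.inr h), huv])]
          rw [skip, value_set]
          have hstep : pivotStep G L u v = L v := by
            unfold pivotStep
            rw [if_pos (not_lt.1 hun)]
            exact if_neg fun h => hadj (h.imp id fun h => h.2)
          refine hf _ (by omega) () _ ⟨⟨?_, ?_, ?_, ?_, ?_, ?_, ?_, ?_⟩, ?_, ?_, ?_, ?_, ?_⟩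
          all_goals try simp [reg_setReg, mem_setReg, Op.eval, h.r0, h.r1, h.r2,
            h.r3, h.r8, h.r9, h.r10, h4, h5, h6, h.out, hj1]
          intro v'
          by_cases hv' : v' = v
          · rw [hv', hmv, hstep, ite_self]
          · simpa using hpost v' hv'
    refine (Sim.loop_pure I (fun s h => h.2.1) (fun i s h => by rw [h.2.1]; omega) hbody n ?_ k φ T
      (fun _ => f (pivotStep G L u)) (fun T₁ h₁ _ s' hs' => hf T₁ h₁ _ s' ⟨hs'.1, hs'.2.2.2.1,
        by omega, hL.step G u, fun v => by rw [hs'.2.2.2.2.2 v, if_pos (Nat.zero_le _)]⟩) _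
      (by omega)).trans (expect_pure _ _).le
    refine ⟨⟨?_, ?_, ?_, ?_, ?_, ?_, ?_, ?_⟩, ?_, le_rfl, ?_, ?_, ?_⟩
    all_goals try simp [reg_setReg, mem_setReg, Op.eval, h.r0, h.r1, h.r2, h.r3, h.r8, h.r9, h.r10,
      h.out, hn, h4, hi1, hu1, hm]

theorem sim_roundPart [NeZero n] {s : Store} (h : Frame n N c b L₀ s)
    (hm : ∀ v : Fin n, s.mem (n + v) = n + v) :
    Sim w G roundPart (N * (18 * n + 14 + 1) + 3) s (iterate (pivotRound G) N fun v => n + (v : ℕ))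
      fun L s' => Frame n N c b L₀ s' ∧ PivotLabels L ∧ ∀ v : Fin n, s'.mem (n + v) = L v := by
  have hNn : N ≤ n * N := Nat.le_mul_of_pos_left N (Nat.pos_of_ne_zero (NeZero.ne n))
  have hN1 : N % 2 ^ w = N := hw _ (by omega)
  let I : ℕ → (Fin n → ℕ) → Store → Prop := fun i L s => Frame n N c b L₀ s ∧ s.reg 4 = i ∧ i ≤ N ∧
    PivotLabels L ∧ ∀ v : Fin n, s.mem (n + v) = L v
  intro k φ T f hf T' hT'
  obtain ⟨T'', rfl⟩ : ∃ T'', T' = T'' + 2 := ⟨T' - 2, by omega⟩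
  simp only [roundPart, value_seq, value_op]
  refine Sim.loop I (pivotRound G) (fun _ s h => h.2.1) (fun i _ s h => by rw [h.2.1]; omega)
    (fun i L s h => sim_roundBody hw hN h.1 h.2.1 h.2.2.1 h.2.2.2.1 h.2.2.2.2) N _ _ ?_ k φ T f
    (fun T₁ h₁ _ s' hs' => hf T₁ h₁ _ s' ⟨hs'.1, hs'.2.2.2⟩) T'' (by omega)
  refine ⟨⟨?_, ?_, ?_, ?_, ?_, ?_, ?_, ?_⟩, ?_, le_rfl, pivotLabels_init, ?_⟩
  all_goals simp [reg_setReg, mem_setReg, Op.eval, h.r0, h.r1, h.r2, h.r3, h.r8, h.r9, h.r10, h.out,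
    hm, hN1]

theorem sim_sampleBody [NeZero n] {s : Store} {L : Fin n → ℕ} {i r : ℕ} (h : Frame n N c b L₀ s)
    (h4 : s.reg 4 = i + 1) (h7 : s.reg 7 = r) (hi : r + (i + 1) ≤ 2 ^ 20 * N) (hL : PivotLabels L)
    (hm : ∀ v : Fin n, s.mem (n + v) = L v) :
    Sim w G sampleBody 27 s (sampleRound G L r) fun r' s' =>
      Frame n N c b L₀ s' ∧ s'.reg 4 = i ∧ s'.reg 7 = r' ∧ r' + i ≤ 2 ^ 20 * N ∧
        ∀ v : Fin n, s'.mem (n + v) = L v := by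
  classical
  have hnN : n ≤ n * N := Nat.le_mul_of_pos_right n hN
  have hNn : N ≤ n * N := Nat.le_mul_of_pos_left N (Nat.pos_of_ne_zero (NeZero.ne n))
  have h1 : 1 % 2 ^ w = 1 := hw _ (by omega)
  have hi1 : i % 2 ^ w = i := hw _ (by omega)
  have hr1 : (r + 1) % 2 ^ w = r + 1 := hw _ (by omega)
  have hr : r % 2 ^ w = r := hw _ (by omega)
  intro k φ T f hf T' hT'
  obtain ⟨T'', rfl⟩ : ∃ T'', T' = T'' + 27 := ⟨T' - 27, by omega⟩
  rw [sampleRound, expect_bind]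
  simp only [sampleBody, value_seq, value_op]
  rw [value_rand _ _ _ _ _ _ _ _ (by simp [reg_setReg, h.r0])]
  refine expect_mono _ fun x => ?_
  rw [expect_map, value_seq, value_rand _ _ _ _ _ _ _ _ (by simp [reg_setReg, h.r0])]
  refine expect_mono _ fun y => ?_
  have hx := x.2
  have hy := y.2
  have hx1 : (x : ℕ) % 2 ^ w = x := hw _ (by omega)
  have hx2 : (n + (x : ℕ)) % 2 ^ w = n + x := hw _ (by omega)
  have hLx : L x % 2 ^ w = L x := hw _ (by have := hL.lt x; omega)
  have hy1 : (y : ℕ) % 2 ^ w = y := hw _ (by omega)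
  have hy2 : (n + (y : ℕ)) % 2 ^ w = n + y := hw _ (by omega)
  have hLy : L y % 2 ^ w = L y := hw _ (by have := hL.lt y; omega)
  simp only [value_seq, value_op, value_load, value_query]
  refine hf _ (by omega) _ _ ⟨⟨?_, ?_, ?_, ?_, ?_, ?_, ?_, ?_⟩, ?_, ?_, ?_, ?_⟩
  all_goals try simp [reg_setReg, mem_setReg, Op.eval, h.r0, h.r1, h.r2, h.r3, h.r8, h.r9, h.r10,
    h.out, h4, hi1, hm]
  · have hxy := @SimpleGraph.Adj.ne _ G x y
    have e : (x : ℕ) = y ↔ x = y := Fin.ext_iff.symm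
    simp only [hx1, hx2, hLx, hy1, hy2, hLy, oracle_fin, h7, hr1, e, hm, Disagree]
    by_cases h8 : x = y
    · subst h8
      simp [h1, hr]
    · by_cases h9 : G.Adj x y <;> by_cases h10 : L x = L y <;>
        simp [h8, h9, h10, h1, hr, hr1]
  · split_ifs <;> omega

theorem sim_samplePart [NeZero n] {s : Store} {L : Fin n → ℕ} (h : Frame n N c b L₀ s)
    (hL : PivotLabels L) (hm : ∀ v : Fin n, s.mem (n + v) = L v) :
    Sim w G samplePart (28 * (2 ^ 20 * N) + 5) s (iterate (sampleRound G L) (2 ^ 20 * N) 0)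
      fun r s' => Frame n N c b L₀ s' ∧ s'.reg 7 = r ∧ r ≤ 2 ^ 20 * N ∧
        ∀ v : Fin n, s'.mem (n + v) = L v := by
  have hNn : N ≤ n * N := Nat.le_mul_of_pos_left N (Nat.pos_of_ne_zero (NeZero.ne n))
  have hN1 : 2 ^ 20 * N % 2 ^ w = 2 ^ 20 * N := hw _ (by omega)
  let I : ℕ → ℕ → Store → Prop := fun i r s => Frame n N c b L₀ s ∧ s.reg 4 = i ∧ s.reg 7 = r ∧
    r + i ≤ 2 ^ 20 * N ∧ ∀ v : Fin n, s.mem (n + v) = L v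
  intro k φ T f hf T' hT'
  obtain ⟨T'', rfl⟩ : ∃ T'', T' = T'' + 4 := ⟨T' - 4, by omega⟩
  simp only [samplePart, value_seq, value_op, value_set]
  refine Sim.loop I (sampleRound G L) (fun _ s h => h.2.1) (fun i _ s h => by rw [h.2.1]; omega)
    (fun i r s h => sim_sampleBody hw hN h.1 h.2.1 h.2.2.1 h.2.2.2.1 hL h.2.2.2.2) (2 ^ 20 * N) _ _
    ?_ k φ T f
    (fun T₁ h₁ _ s' hs' => hf T₁ h₁ _ s' ⟨hs'.1, hs'.2.2⟩) T'' (by omega)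
  refine ⟨⟨?_, ?_, ?_, ?_, ?_, ?_, ?_, ?_⟩, ?_, ?_, ?_, ?_⟩
  all_goals simp [reg_setReg, mem_setReg, Op.eval, h.r0, h.r1, h.r2, h.r3, h.r8, h.r9, h.r10, h.out,
    hm]
  exact hN1

theorem sim_comparePart [NeZero n] {s : Store} {L : Fin n → ℕ} {r : ℕ} (h : Frame n N c b L₀ s)
    (hL : PivotLabels L) (h7 : s.reg 7 = r) (hr : r ≤ 2 ^ 20 * (n * N))
    (hm : ∀ v : Fin n, s.mem (n + v) = L v) :
    Sim w G comparePart (8 * n + 8) s (PMF.pure (if r < b then (L, r) else (L₀, b)))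
      fun a => Frame n N c a.2 a.1 := by
  have hnN : n ≤ n * N := Nat.le_mul_of_pos_right n hN
  have hn : n % 2 ^ w = n := hw _ (by omega)
  have hr1 : r % 2 ^ w = r := hw _ (by omega)
  intro k φ T f hf T' hT'
  obtain ⟨T'', rfl⟩ : ∃ T'', T' = T'' + 7 := ⟨T' - 7, by omega⟩
  rw [expect_pure]
  simp only [comparePart, value_seq, value_op]
  by_cases hrb : r < b
  · rw [if_pos hrb, value_ite_of_ne _ _ _ _ _ _ _ _ _ (by
      have h1 : 1 % 2 ^ w = 1 := hw _ (by
        have := Nat.pos_of_ne_zero (NeZero.ne n)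
        omega)
      simp [reg_setReg, Op.eval, h7, h.r3, hrb, h1])]
    simp only [value_seq, value_op]
    let I : ℕ → Store → Prop := fun j s =>
      Frame n N c r (fun v => if j ≤ v then L v else L₀ v) s ∧ s.reg 5 = j ∧ j ≤ n ∧
      ∀ v : Fin n, s.mem (n + v) = L v
    have hbody : ∀ j s, I (j + 1) s → Sim w G copyBody 7 s (PMF.pure ()) fun _ => I j := by
      rintro j s ⟨h, h5, hj, hm⟩ k φ T f hf T' hT'
      obtain ⟨T'', rfl⟩ : ∃ T'', T' = T'' + 7 := ⟨T' - 7, by omega⟩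
      have hj1 : j % 2 ^ w = j := hw _ (by omega)
      have hj2 : (n + j) % 2 ^ w = n + j := hw _ (by omega)
      obtain ⟨v, rfl⟩ : ∃ v : Fin n, (v : ℕ) = j := ⟨⟨j, by omega⟩, rfl⟩
      have hLv : L v % 2 ^ w = L v := hw _ (by have := hL.lt v; omega)
      rw [expect_pure]
      simp only [copyBody, value_seq, value_op, value_load, value_store]
      refine hf _ (by omega) () _ ⟨⟨?_, ?_, ?_, ?_, ?_, ?_, ?_, ?_⟩, ?_, ?_, ?_⟩
      all_goals try simp [reg_setReg, mem_setReg, reg_setMem, mem_setMem, Op.eval, h.r0, h.r1, h.r2,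
        h.r3, h.r8, h.r9, h.r10, h5, hj1, hj2, hm, hLv]
      · intro v'
        by_cases hv' : v' = v
        · simp [hv']
        · have hne : (v' : ℕ) ≠ v := fun h => hv' (Fin.ext h)
          rw [if_neg hne, h.out]
          by_cases hle : (v : ℕ) ≤ v'
          · rw [if_pos (by omega), if_pos (by simpa using hle)]
          · rw [if_neg (by omega), if_neg (by simpa using hle)]
      · intro v' h'
        have := v.2
        omega
    refine (Sim.loop_pure I (fun s h => h.2.1) (fun i s h => by rw [h.2.1]; omega) hbody n ?_ k φ T
      (fun _ => f (L, r)) (fun T₁ h₁ _ s' hs' => hf T₁ h₁ _ s' (by simpa using hs'.1)) _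
      (by omega)).trans (expect_pure _ _).le
    refine ⟨⟨?_, ?_, ?_, ?_, ?_, ?_, ?_, ?_⟩, ?_, le_rfl, ?_⟩
    all_goals try simp [reg_setReg, mem_setReg, Op.eval, h.r0, h.r1, h.r2, h.r3, h.r8, h.r9, h.r10,
      h.out, hn, h7, hr1, hm]
  · rw [if_neg hrb, value_ite_of_eq _ _ _ _ _ _ _ _ _ (by
      simp [reg_setReg, Op.eval, h7, h.r3, hrb])]
    rw [skip, value_set]
    refine hf _ (by omega) _ _ ⟨?_, ?_, ?_, ?_, ?_, ?_, ?_, ?_⟩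
    all_goals simp [reg_setReg, mem_setReg, h.r0, h.r1, h.r2, h.r3, h.r8, h.r9, h.r10, h.out]

omit hw hN in
theorem Sim.op_seq {α : Type*} {s : Store} {f : Op} {d x y t : ℕ} {Q : Prog} {μ : PMF α}
    {R : α → Store → Prop} (h : Sim w G Q t (s.setReg w d (f.eval (s.reg x) (s.reg y))) μ R) :
    Sim w G (.op f d x y ;; Q) (t + 2) s μ R := by
  intro k φ T g hg T' hT'
  obtain ⟨T'', rfl⟩ : ∃ T'', T' = T'' + 2 := ⟨T' - 2, by omega⟩
  rw [value_seq, value_op]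
  exact h k φ T g hg T'' (by omega)

omit hw hN in
theorem Sim.set_seq {α : Type*} {s : Store} {d v t : ℕ} {Q : Prog} {μ : PMF α}
    {R : α → Store → Prop} (h : Sim w G Q t (s.setReg w d v) μ R) :
    Sim w G (.set d v ;; Q) (t + 2) s μ R := by
  intro k φ T g hg T' hT'
  obtain ⟨T'', rfl⟩ : ∃ T'', T' = T'' + 2 := ⟨T' - 2, by omega⟩
  rw [value_seq, value_set]
  exact h k φ T g hg T'' (by omega)

theorem sim_candidateBody [NeZero n] {s : Store} {i : ℕ} (h : Frame n N (i + 1) b L₀ s)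
    (hi : i + 1 ≤ 16) :
    Sim w G candidateBody (14 * n + N * (18 * n + 15) + 28 * (2 ^ 20 * N) + 24) s
      (improve G N (2 ^ 20 * N) (L₀, b)) fun a => Frame n N i a.2 a.1 := by
  have hNn : N ≤ n * N := Nat.le_mul_of_pos_left N (Nat.pos_of_ne_zero (NeZero.ne n))
  have hi1 : i % 2 ^ w = i := hw _ (by omega)
  have hdist : improve G N (2 ^ 20 * N) (L₀, b) =
      (iterate (pivotRound G) N fun v => n + (v : ℕ)).bind fun L =>
        (iterate (sampleRound G L) (2 ^ 20 * N) 0).bind fun r =>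
          PMF.pure (if r < b then (L, r) else (L₀, b)) := by
    rw [improve, candidate, PMF.map_bind]
    simp only [PMF.map_comp]
    rfl
  rw [hdist]
  refine Sim.mono (Sim.op_seq (Sim.seq_pure (sim_initPart hw hN (c := i) (b := b) (L₀ := L₀) ?_)
    fun s' hs' => Sim.seq (sim_roundPart hw hN hs'.1 hs'.2) fun L s' hs' =>
      Sim.seq (sim_samplePart hw hN hs'.1 hs'.2.1 hs'.2.2) fun r s'' hs'' =>
        sim_comparePart hw hN hs''.1 hs'.2.1 hs''.2.1 (hs''.2.2.1.trans (by omega)) hs''.2.2.2))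
    (le_of_eq (by ring)) (fun _ _ h => h)
  refine ⟨?_, ?_, ?_, ?_, ?_, ?_, ?_, ?_⟩
  all_goals simp [reg_setReg, mem_setReg, Op.eval, h.r0, h.r1, h.r2, h.r3, h.r8, h.r9, h.r10, h.out,
    hi1]

/-- The program simulates 16 rounds of `improve` in time linear in `n * N`. -/
theorem sim_clusterProg [NeZero n] :
    Sim w G clusterProg (2 ^ 29 * (n * N))
      ⟨fun i => if i = 0 then n else if i = 1 then N else 0, fun _ => 0⟩
      (iterate (improve G N (2 ^ 20 * N)) 16 (fun _ => 0, 2 ^ 20 * N + 1))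
      fun a => Frame n N 0 a.2 a.1 := by
  have hnN : n ≤ n * N := Nat.le_mul_of_pos_right n hN
  have hn := Nat.pos_of_ne_zero (NeZero.ne n)
  have hNn : N ≤ n * N := Nat.le_mul_of_pos_left N hn
  have h1 : 1 % 2 ^ w = 1 := hw _ (by omega)
  have h16 : 16 % 2 ^ w = 16 := hw _ (by omega)
  have h20 : 1048576 % 2 ^ w = 1048576 := hw _ (by omega)
  have hm : 1048576 * N % 2 ^ w = 1048576 * N := hw _ (by omega)
  have hm1 : (1048576 * N + 1) % 2 ^ w = 1048576 * N + 1 := hw _ (by omega)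
  let I : ℕ → (Fin n → ℕ) × ℕ → Store → Prop := fun i a s => Frame n N i a.2 a.1 s ∧ i ≤ 16
  have hloop := fun s h => Sim.loop (w := w) (G := G) (a := 2) I (improve G N (2 ^ 20 * N))
    (fun _ s h => h.1.r2) (fun i _ s h => by rw [h.1.r2]; omega)
    (fun i a s h => (sim_candidateBody hw hN h.1 h.2).mono le_rfl
      fun _ _ h' => ⟨h', by have := h.2; omega⟩) 16 (fun _ => 0, 2 ^ 20 * N + 1) s h
  refine Sim.mono (Sim.set_seq (Sim.set_seq (Sim.set_seq (Sim.op_seq (Sim.op_seq (hloop _ ?_))))))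
    ?_ (fun _ _ h => h.1)
  · refine ⟨⟨?_, ?_, ?_, ?_, ?_, ?_, ?_, ?_⟩, le_rfl⟩
    all_goals simp [reg_setReg, mem_setReg, Op.eval, h1, h16, h20, hm, hm1]
  · have h2 : N * (18 * n + 15) = 18 * (n * N) + 15 * N := by ring
    omega

end Program

section UpperBound

theorem mod_two_pow_wordLength {n N : ℕ} (h : 1 ≤ n * N) (x : ℕ) (hx : x ≤ 2 ^ 22 * (n * N)) :
    x % 2 ^ wordLength 23 n N = x := by
  refine Nat.mod_eq_of_lt (hx.trans_lt ?_)
  have h1 : n * N < 2 ^ (n * N).size := Nat.lt_size_self _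
  have h2 : 1 ≤ (n * N).size := Nat.size_pos.2 h
  calc 2 ^ 22 * (n * N) < 2 ^ 22 * 2 ^ (n * N).size := by omega
    _ = 2 ^ (22 + (n * N).size) := (pow_add ..).symm
    _ ≤ 2 ^ wordLength 23 n N := Nat.pow_le_pow_right (by norm_num) (by unfold wordLength; omega)

theorem isApprox_of_not_costly {n N : ℕ} {G : SimpleGraph (Fin n)} {L : Fin n → ℕ} {ε : ℝ}
    (hN : 1 ≤ N) (hε : 1 ≤ ε * N) (h : ¬ Costly G N L) : IsApprox G 4 ε L := by
  have hN' : (0 : ℝ) < N := by exact_mod_cast hN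
  have h1 : N * (2 * cost G L) ≤ 8 * N * opt G + 2 * n ^ 2 := by
    rw [← pairCost_eq]
    exact not_lt.1 h
  have h2 : (N : ℝ) * (2 * cost G L) ≤ 8 * N * opt G + 2 * (n : ℝ) ^ 2 := by exact_mod_cast h1
  unfold IsApprox
  refine le_of_mul_le_mul_left ?_ hN'
  nlinarith [sq_nonneg (n : ℝ)]

open Classical in
/-- The quantity whose expectation is bounded for the upper bound: `∞` for a configuration that has
not halted, and otherwise the indicator of an insufficient clustering. -/
noncomputable def failure {n : ℕ} (G : SimpleGraph (Fin n)) (ε : ℝ) (D : Config) : ENNReal :=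
  if D.Halted then if IsApprox G 4 ε (D.clustering n) then 0 else 1 else ⊤

theorem clusterProg_correct {ε : ℝ} (hε : 0 < ε) (hε1 : ε < 1) {n : ℕ} (hn : 1 ≤ n)
    (G : SimpleGraph (Fin n)) :
    value (wordLength 23 n ⌈1 / ε⌉₊) G (failure G ε) ⌊2 ^ 30 * (n : ℝ) / ε⌋₊
      (start clusterProg n ⌈1 / ε⌉₊) ≤ 1 / 3 := by
  classical
  have : NeZero n := ⟨by omega⟩
  set N := ⌈1 / ε⌉₊ with hNdef
  have hN1 : 1 / ε ≤ N := Nat.le_ceil _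
  have hN : 1 ≤ N := Nat.one_le_ceil_iff.2 (by positivity)
  have hN2 : (N : ℝ) ≤ 2 * (1 / ε) := by
    have h1 := Nat.ceil_lt_add_one (a := 1 / ε) (by positivity)
    have h2 : 1 ≤ 1 / ε := by rw [le_div_iff₀ hε]; linarith
    linarith
  have hεN : 1 ≤ ε * N := by
    have := mul_le_mul_of_nonneg_left hN1 hε.le
    rwa [mul_one_div_cancel hε.ne'] at this
  have hT : 2 ^ 29 * (n * N) ≤ ⌊2 ^ 30 * (n : ℝ) / ε⌋₊ := by
    refine Nat.le_floor ?_
    rw [Nat.cast_mul, Nat.cast_mul, Nat.cast_pow, Nat.cast_ofNat]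
    calc (2 : ℝ) ^ 29 * (n * N) ≤ 2 ^ 29 * (n * (2 * (1 / ε))) := by gcongr
      _ = 2 ^ 30 * n / ε := by ring
  have hnN : 1 ≤ n * N := Nat.mul_pos hn hN
  refine le_trans ?_ (expect_best_bad_le G N hN)
  refine sim_clusterProg (mod_two_pow_wordLength hnN) hN [] (failure G ε) 0 _
    (fun T' _ a s' h => ?_) _ (by simpa using hT)
  rw [value_halted, failure, if_pos (show Config.Halted ⟨[], s'⟩ from rfl)]
  have hcl : Config.clustering ⟨[], s'⟩ n = a.1 := funext h.out
  rw [hcl]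
  by_cases hc : Costly G N a.1
  · rw [if_pos hc]
    split_ifs <;> simp
  · rw [if_pos (isApprox_of_not_costly hN hεN hc)]
    exact zero_le

theorem halted_of_expect_failure_ne_top {n : ℕ} {G : SimpleGraph (Fin n)} {ε : ℝ} {μ : PMF Config}
    (h : expect μ (failure G ε) ≤ 1 / 3) : ∀ D ∈ μ.support, D.Halted := by
  intro D hD
  by_contra hD'
  have h1 : μ D * failure G ε D ≤ 1 / 3 := (ENNReal.le_tsum D).trans h
  rw [failure, if_neg hD', ENNReal.mul_top ((PMF.mem_support_iff ..).1 hD)] at h1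
  exact absurd h1 (by simp)

theorem le_prob_isApprox {n : ℕ} {G : SimpleGraph (Fin n)} {ε : ℝ} {μ : PMF Config}
    (h : expect μ (failure G ε) ≤ 1 / 3) :
    2 / 3 ≤ μ.toOuterMeasure {D | IsApprox G 4 ε (D.clustering n)} := by
  classical
  rw [PMF.toOuterMeasure_apply]
  have h1 : (1 : ENNReal) ≤ ∑' D, Set.indicator {D | IsApprox G 4 ε (D.clustering n)} μ D + 1 / 3 := by
    refine le_trans ?_ (add_le_add_right h _)
    rw [expect, ← ENNReal.tsum_add, ← μ.tsum_coe]
    refine ENNReal.tsum_le_tsum fun D => ?_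
    by_cases hD : IsApprox G 4 ε (D.clustering n)
    · rw [Set.indicator_of_mem (by exact hD)]
      exact le_self_add
    · rw [Set.indicator_of_notMem (by exact hD), zero_add, failure, if_neg hD]
      refine (mul_one (μ D)).symm.le.trans (mul_le_mul_right ?_ _)
      split_ifs <;> simp
  have h2 : (2 / 3 : ENNReal) + 1 / 3 = 1 := by
    rw [← ENNReal.add_div]
    norm_num
    exact ENNReal.div_self (by simp) (by simp)
  exact (ENNReal.add_le_add_iff_right (a := 1 / 3) (by finiteness)).1 (h2.le.trans h1)

end UpperBound

/-! ### Hard instances: disjoint cliques with a public part -/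

section HardInstances

variable {n k : ℕ}

/-- The disjoint union of cliques on the classes of `σ`. -/
def clusterGraph (σ : Fin n → Fin k) : SimpleGraph (Fin n) where
  Adj x y := x ≠ y ∧ σ x = σ y
  symm := ⟨fun _ _ h => ⟨h.1.symm, h.2.symm⟩⟩
  loopless := ⟨fun _ h => h.1 rfl⟩

theorem opt_clusterGraph (σ : Fin n → Fin k) : opt (clusterGraph σ) = 0 := by
  classical
  refine Nat.le_zero.1 ((ciInf_le ⟨0, fun _ _ => Nat.zero_le _⟩ fun v => (σ v : ℕ)).trans ?_)
  rw [cost, Nat.le_zero, Finset.card_eq_zero, Finset.filter_eq_empty_iff]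
  rintro ⟨x, y⟩ - ⟨hlt, h⟩
  simp only [clusterGraph, ne_eq, Fin.val_inj] at h
  have := hlt.ne
  tauto

/-- The factor `(1 + j) / 2` for a vertex with `j` possible classes: the sum over these classes of
`1` for a correct and `1 / 2` for a wrong guess. -/
noncomputable def weight (s : Finset (Fin k)) : ℝ := (s.card + 1) / 2

theorem sum_guess_le (s : Finset (Fin k)) (g : Fin k) :
    ∑ j ∈ s, (if g ≠ j then (1 / 2 : ℝ) else 1) ≤ weight s := by
  have h : ∀ j, (if g ≠ j then (1 / 2 : ℝ) else 1) = 1 / 2 + (if g = j then 1 / 2 else 0) := by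
    intro j
    by_cases hj : g = j
    · simp [hj]; norm_num
    · simp [hj]
  simp only [h, Finset.sum_add_distrib, Finset.sum_ite_eq, Finset.sum_const, nsmul_eq_mul, weight]
  split_ifs <;> linarith

/-- The number of vertices whose class under `σ` is not the one that `guess` derives from the
output of the algorithm. -/
def wrong (guess : (Fin n → ℕ) → Fin n → Fin k) (σ : Fin n → Fin k) (cl : Fin n → ℕ) : ℕ :=
  (Finset.univ.filter fun v => guess cl v ≠ σ v).card

theorem weight_pos (s : Finset (Fin k)) : 0 < weight s := by
  unfold weight
  positivity

theorem weight_singleton (j : Fin k) : weight {j} = 1 := by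
  norm_num [weight]

/-- Revealing that `x` and `y` both have class `j` removes their factors. -/
theorem prod_weight_update (S : Fin n → Finset (Fin k)) {x y : Fin n} (hxy : x ≠ y) (j : Fin k) :
    (∏ z, weight (Function.update (Function.update S x {j}) y {j} z)) *
      (weight (S x) * weight (S y)) = ∏ z, weight (S z) := by
  have h : ∀ z, weight (S z) = weight (Function.update (Function.update S x {j}) y {j} z) *
      ((if z = x then weight (S x) else 1) * (if z = y then weight (S y) else 1)) := by
    intro z
    by_cases hzy : z = y
    · subst hzy
      simp [hxy.symm, weight_singleton]
    · by_cases hzx : z = x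
      · subst hzx
        simp [hxy, weight_singleton]
      · simp [hzx, hzy]
  rw [Finset.prod_congr rfl fun z _ => h z, Finset.prod_mul_distrib, Finset.prod_mul_distrib]
  simp

variable (guess : (Fin n → ℕ) → Fin n → Fin k)

/-- An algorithm with at most `q` queries cannot guess many classes: each query improves the bound
for the exponential moment of the number of wrong guesses by a factor `1 + 4 / k` at most.
The vertices in question have either a known class or an arbitrary one. After the answer "no" the
information that it gives is discarded; after the answer "yes" the common class is revealed. -/
theorem sum_wrong_le (hk : 1 ≤ k) (t : QueryAlg n) : ∀ (q : ℕ) (S : Fin n → Finset (Fin k)),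
    (∀ x, S x = Finset.univ ∨ ∃ j, S x = {j}) →
    ∑ σ ∈ (Fintype.piFinset S).filter (fun σ => t.queries (clusterGraph σ) ≤ q),
      (1 / 2 : ℝ) ^ wrong guess σ (t.result (clusterGraph σ)) ≤
    (1 + 4 / k) ^ q * ∏ x, weight (S x) := by
  classical
  have hk' : (1 : ℝ) ≤ k := by exact_mod_cast hk
  have hθ : (1 : ℝ) ≤ 1 + 4 / k := by
    have : (0 : ℝ) ≤ 4 / k := by positivity
    linarith
  induction t with
  | output cl =>
    intro q S _
    have h1 : ∀ σ : Fin n → Fin k, (1 / 2 : ℝ) ^ wrong guess σ cl =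
        ∏ v, if guess cl v ≠ σ v then (1 / 2 : ℝ) else 1 := by
      intro σ
      rw [wrong, Finset.prod_ite, Finset.prod_const, Finset.prod_const_one, mul_one]
    have hpos : 0 ≤ ∏ x, weight (S x) := Finset.prod_nonneg fun x _ => (weight_pos _).le
    calc _ = ∑ σ ∈ Fintype.piFinset S, ∏ v, if guess cl v ≠ σ v then (1 / 2 : ℝ) else 1 := by
          refine Finset.sum_congr ?_ fun σ _ => ?_
          · exact Finset.filter_true_of_mem fun σ _ => by simp [QueryAlg.queries]
          · rw [QueryAlg.result, h1]
      _ = ∏ v, ∑ j ∈ S v, if guess cl v ≠ j then (1 / 2 : ℝ) else 1 :=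
          (Finset.prod_univ_sum S fun v j => if guess cl v ≠ j then (1 / 2 : ℝ) else 1).symm
      _ ≤ ∏ v, weight (S v) := by
          refine Finset.prod_le_prod (fun v _ => Finset.sum_nonneg fun j _ => ?_)
            fun v _ => sum_guess_le _ _
          split_ifs <;> norm_num
      _ ≤ _ := le_mul_of_one_le_left hpos (one_le_pow₀ hθ)
  | ask x y no yes ihno ihyes =>
    intro q S hS
    have hpos : 0 ≤ ∏ x, weight (S x) := Finset.prod_nonneg fun x _ => (weight_pos _).le
    rcases q with _ | q
    · rw [Finset.filter_false_of_mem]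
      · rw [Finset.sum_empty]
        positivity
      · intro σ _
        simp [QueryAlg.queries]
    set F := (Fintype.piFinset S).filter fun σ =>
      (QueryAlg.ask x y no yes).queries (clusterGraph σ) ≤ q + 1
    have hstep : (1 + 4 / (k : ℝ)) ^ q * ∏ x, weight (S x) ≤
        (1 + 4 / (k : ℝ)) ^ (q + 1) * ∏ x, weight (S x) :=
      mul_le_mul_of_nonneg_right (pow_le_pow_right₀ hθ (Nat.le_succ q)) hpos
    have hno : ∑ σ ∈ F.filter (fun σ => ¬ (clusterGraph σ).Adj x y), (1 / 2 : ℝ) ^ wrong guess σ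
        ((QueryAlg.ask x y no yes).result (clusterGraph σ)) ≤
        (1 + 4 / k) ^ q * ∏ x, weight (S x) := by
      refine le_trans ?_ (ihno q S hS)
      refine (Finset.sum_congr rfl fun σ hσ => ?_).trans_le
        (Finset.sum_le_sum_of_subset_of_nonneg (fun σ hσ => ?_) fun σ _ _ => by positivity)
      · rw [QueryAlg.result, if_neg (Finset.mem_filter.1 hσ).2]
      · obtain ⟨h1, h2⟩ := Finset.mem_filter.1 hσ
        obtain ⟨h3, h4⟩ := Finset.mem_filter.1 h1
        rw [QueryAlg.queries, if_neg h2] at h4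
        exact Finset.mem_filter.2 ⟨h3, by omega⟩
    have hyes : ∀ S' : Fin n → Finset (Fin k), (∀ x, S' x = Finset.univ ∨ ∃ j, S' x = {j}) →
        ∀ F' ⊆ F.filter (fun σ => (clusterGraph σ).Adj x y), F' ⊆ Fintype.piFinset S' →
        ∑ σ ∈ F', (1 / 2 : ℝ) ^ wrong guess σ
          ((QueryAlg.ask x y no yes).result (clusterGraph σ)) ≤
        (1 + 4 / k) ^ q * ∏ x, weight (S' x) := by
      intro S' hS' F' hF hF'
      refine le_trans ?_ (ihyes q S' hS')
      refine (Finset.sum_congr rfl fun σ hσ => ?_).trans_le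
        (Finset.sum_le_sum_of_subset_of_nonneg (fun σ hσ => ?_) fun σ _ _ => by positivity)
      · rw [QueryAlg.result, if_pos (Finset.mem_filter.1 (hF hσ)).2]
      · obtain ⟨h1, h2⟩ := Finset.mem_filter.1 (hF hσ)
        obtain ⟨h3, h4⟩ := Finset.mem_filter.1 h1
        rw [QueryAlg.queries, if_pos h2] at h4
        exact Finset.mem_filter.2 ⟨hF' hσ, by omega⟩
    rw [← Finset.sum_filter_add_sum_filter_not F fun σ => (clusterGraph σ).Adj x y]
    by_cases hxy : x = y
    · rw [Finset.filter_false_of_mem fun σ _ h => h.1 hxy, Finset.sum_empty, zero_add]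
      exact hno.trans hstep
    by_cases hsing : (∃ i, S x = {i}) ∧ ∃ j, S y = {j}
    · obtain ⟨⟨i, hi⟩, j, hj⟩ := hsing
      have hval : ∀ σ ∈ F, σ x = i ∧ σ y = j := by
        intro σ hσ
        have h := Fintype.mem_piFinset.1 (Finset.mem_filter.1 hσ).1
        have hx := h x
        have hy := h y
        rw [hi, Finset.mem_singleton] at hx
        rw [hj, Finset.mem_singleton] at hy
        exact ⟨hx, hy⟩
      by_cases hij : i = j
      · rw [Finset.filter_false_of_mem (p := fun σ => ¬ (clusterGraph σ).Adj x y), Finset.sum_empty,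
          add_zero]
        · exact (hyes S hS _ subset_rfl fun σ hσ => (Finset.mem_filter.1
            (Finset.mem_filter.1 hσ).1).1).trans hstep
        · intro σ hσ h
          exact h ⟨hxy, by rw [(hval σ hσ).1, (hval σ hσ).2, hij]⟩
      · rw [Finset.filter_false_of_mem (p := fun σ => (clusterGraph σ).Adj x y), Finset.sum_empty,
          zero_add]
        · exact hno.trans hstep
        · intro σ hσ h
          exact hij (by rw [← (hval σ hσ).1, ← (hval σ hσ).2, h.2])
    have hcard : ((S x ∩ S y).card : ℝ) ≤ 4 / k * (weight (S x) * weight (S y)) := by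
      have hk0 : (0 : ℝ) < k := by linarith
      rw [div_mul_eq_mul_div, le_div_iff₀ hk0]
      rcases hS x with hx | ⟨i, hx⟩ <;> rcases hS y with hy | ⟨j, hy⟩
      · simp only [hx, hy, Finset.inter_self, Finset.card_univ, Fintype.card_fin, weight]
        nlinarith
      · simp only [hx, hy, Finset.univ_inter, Finset.card_univ, Fintype.card_fin, weight,
          Finset.card_singleton]
        push_cast
        linarith
      · simp only [hx, hy, Finset.inter_univ, Finset.card_univ, Fintype.card_fin, weight,
          Finset.card_singleton]
        push_cast
        linarith
      · exact absurd ⟨⟨i, hx⟩, j, hy⟩ hsing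
    have hyes' : ∑ σ ∈ F.filter (fun σ => (clusterGraph σ).Adj x y), (1 / 2 : ℝ) ^ wrong guess σ
        ((QueryAlg.ask x y no yes).result (clusterGraph σ)) ≤
        4 / k * ((1 + 4 / k) ^ q * ∏ x, weight (S x)) := by
      rw [← Finset.sum_fiberwise_of_maps_to (t := S x ∩ S y) (g := fun σ => σ x)]
      · set w := weight (S x) * weight (S y) with hw
        have hw0 : 0 < w := mul_pos (weight_pos _) (weight_pos _)
        calc _ ≤ ∑ _j ∈ S x ∩ S y, (1 + 4 / (k : ℝ)) ^ q * ((∏ x, weight (S x)) / w) := by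
              refine Finset.sum_le_sum fun j _ => ?_
              rw [← prod_weight_update S hxy j, ← hw, mul_div_assoc, div_self hw0.ne', mul_one]
              refine hyes _ (fun z => ?_) _ (Finset.filter_subset _ _) fun σ hσ => ?_
              · by_cases hzy : z = y
                · exact Or.inr ⟨j, by simp [hzy]⟩
                · by_cases hzx : z = x
                  · exact Or.inr ⟨j, by simp [hzx, hxy]⟩
                  · simpa [hzx, hzy] using hS z
              · obtain ⟨h1, h2⟩ := Finset.mem_filter.1 hσ
                obtain ⟨h3, h4⟩ := Finset.mem_filter.1 h1
                have h5 := Fintype.mem_piFinset.1 (Finset.mem_filter.1 h3).1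
                refine Fintype.mem_piFinset.2 fun z => ?_
                by_cases hzy : z = y
                · subst hzy
                  simpa using h4.2.symm.trans h2
                · by_cases hzx : z = x
                  · subst hzx
                    simpa [hzy] using h2
                  · simpa [hzx, hzy] using h5 z
          _ = (S x ∩ S y).card * ((1 + 4 / (k : ℝ)) ^ q * ((∏ x, weight (S x)) / w)) := by
              rw [Finset.sum_const, nsmul_eq_mul]
          _ ≤ (4 / k * w) * ((1 + 4 / (k : ℝ)) ^ q * ((∏ x, weight (S x)) / w)) :=
              mul_le_mul_of_nonneg_right hcard (by positivity)
          _ = _ := by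
              field_simp
      · intro σ hσ
        obtain ⟨h1, h2⟩ := Finset.mem_filter.1 hσ
        have h5 := Fintype.mem_piFinset.1 (Finset.mem_filter.1 h1).1
        refine Finset.mem_inter.2 ⟨h5 x, ?_⟩
        rw [h2.2]
        exact h5 y
    refine (add_le_add hyes' hno).trans (le_of_eq ?_)
    rw [pow_succ]
    ring

/-- Guess the class in which the label of `v` occurs most frequently among the vertices in `A`, whose
classes `τ` are public. -/
theorem exists_guess [NeZero k] (A : Finset (Fin n)) (τ : Fin n → Fin k) :
    ∃ guess : (Fin n → ℕ) → Fin n → Fin k, ∀ cl v, (v ∈ A → guess cl v = τ v) ∧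
      (v ∉ A → ∀ j, (A.filter fun x => τ x = j ∧ cl x = cl v).card ≤
        (A.filter fun x => τ x = guess cl v ∧ cl x = cl v).card) := by
  classical
  have h : ∀ (cl : Fin n → ℕ) (v : Fin n), ∃ i : Fin k,
      ∀ j, (A.filter fun x => τ x = j ∧ cl x = cl v).card ≤
        (A.filter fun x => τ x = i ∧ cl x = cl v).card := by
    intro cl v
    obtain ⟨i, -, hi⟩ := Finset.exists_max_image (Finset.univ : Finset (Fin k))
      (fun j => (A.filter fun x => τ x = j ∧ cl x = cl v).card) Finset.univ_nonempty
    exact ⟨i, fun j => hi j (Finset.mem_univ j)⟩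
  choose g hg using h
  refine ⟨fun cl v => if v ∈ A then τ v else g cl v, fun cl v => ⟨fun hv => if_pos hv,
    fun hv => ?_⟩⟩
  simpa only [if_neg hv] using hg cl v

/-- A vertex that is guessed wrongly is in disagreement with at least `h` vertices of the public
part. -/
theorem mul_wrong_le_cost {A : Finset (Fin n)} {τ : Fin n → Fin k} {h : ℕ}
    (hA : ∀ x ∈ A, ∀ v ∉ A, x < v) (hh : ∀ j, h ≤ (A.filter fun x => τ x = j).card)
    {guess : (Fin n → ℕ) → Fin n → Fin k} (hguess : ∀ cl v, (v ∈ A → guess cl v = τ v) ∧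
      (v ∉ A → ∀ j, (A.filter fun x => τ x = j ∧ cl x = cl v).card ≤
        (A.filter fun x => τ x = guess cl v ∧ cl x = cl v).card))
    {σ : Fin n → Fin k} (hσ : ∀ x ∈ A, σ x = τ x) (cl : Fin n → ℕ) :
    h * wrong guess σ cl ≤ cost (clusterGraph σ) cl := by
  classical
  set W := Finset.univ.filter fun v => guess cl v ≠ σ v with hW
  set E := (Finset.univ : Finset (Fin n × Fin n)).filter fun e =>
    e.1 < e.2 ∧ (((clusterGraph σ).Adj e.1 e.2 ∧ cl e.1 ≠ cl e.2) ∨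
      (¬ (clusterGraph σ).Adj e.1 e.2 ∧ cl e.1 = cl e.2)) with hE
  have hcost : cost (clusterGraph σ) cl = E.card := by
    rw [cost, hE]
  have hfib : ∀ v ∈ W, h ≤ ((E.filter fun e => e.2 ∈ W).filter fun e => e.2 = v).card := by
    intro v hv
    have hv' : guess cl v ≠ σ v := (Finset.mem_filter.1 hv).2
    have hvA : v ∉ A := fun hvA => hv' (((hguess cl v).1 hvA).trans (hσ v hvA).symm)
    set X := A.filter fun x => τ x = σ v ∧ cl x ≠ cl v
    set Y := A.filter fun x => τ x = guess cl v ∧ cl x = cl v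
    have hdisj : Disjoint X Y := by
      rw [Finset.disjoint_filter]
      rintro x - h1 h2
      exact h1.2 h2.2
    have h1 : h ≤ (X ∪ Y).card := by
      have h2 : (A.filter fun x => τ x = σ v).card =
          (A.filter fun x => τ x = σ v ∧ cl x = cl v).card + X.card := by
        rw [← Finset.card_filter_add_card_filter_not (fun x => cl x = cl v), Finset.filter_filter,
          Finset.filter_filter]
      have h3 : (A.filter fun x => τ x = σ v ∧ cl x = cl v).card ≤ Y.card :=
        (hguess cl v).2 hvA (σ v)
      have h4 := hh (σ v)
      rw [Finset.card_union_of_disjoint hdisj]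
      omega
    refine h1.trans (Finset.card_le_card_of_injOn (fun x => (x, v)) (fun x hx => ?_)
      fun x _ y _ hxy => (Prod.ext_iff.1 hxy).1)
    have hmem : x ∈ A ∧ (((clusterGraph σ).Adj x v ∧ cl x ≠ cl v) ∨
        (¬ (clusterGraph σ).Adj x v ∧ cl x = cl v)) := by
      rcases Finset.mem_union.1 hx with hx | hx
      · obtain ⟨h5, h6, h7⟩ := Finset.mem_filter.1 hx
        refine ⟨h5, Or.inl ⟨⟨fun h8 => hvA (h8 ▸ h5), ?_⟩, h7⟩⟩
        rw [hσ x h5, h6]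
      · obtain ⟨h5, h6, h7⟩ := Finset.mem_filter.1 hx
        refine ⟨h5, Or.inr ⟨fun h8 => hv' ?_, h7⟩⟩
        rw [← h6, ← hσ x h5, h8.2]
    simp only [Finset.coe_filter, Finset.mem_filter, Set.mem_ofPred_eq, hE, Finset.mem_univ,
      true_and, and_true]
    exact ⟨⟨hA x hmem.1 v hvA, hmem.2⟩, hv⟩
  rw [hcost]
  calc h * W.card = ∑ _v ∈ W, h := by rw [Finset.sum_const, smul_eq_mul, mul_comm]
    _ ≤ ∑ v ∈ W, ((E.filter fun e => e.2 ∈ W).filter fun e => e.2 = v).card :=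
        Finset.sum_le_sum hfib
    _ = (E.filter fun e => e.2 ∈ W).card :=
        (Finset.card_eq_sum_card_fiberwise fun e he => (Finset.mem_filter.1 he).2).symm
    _ ≤ E.card := Finset.card_filter_le _ _

end HardInstances

/-! ### The query lower bound -/

section LowerBound

/-- The parameters of the hard instances: `k` cliques with `h` public vertices each. At most half
of the vertices are public, and a wrongly placed vertex costs at least `9 * ε * n`. -/
theorem exists_parameters {n : ℕ} {ε : ℝ} (h1 : 1 < ε * n) (h2 : ε < 1 / 100) :
    ∃ k h : ℕ, 5 ≤ k ∧ 2 * (k * h) ≤ n ∧ 9 * ε * n ≤ h ∧ 1 ≤ 25 * ε * k := by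
  have hn : (0 : ℝ) ≤ n := Nat.cast_nonneg n
  have hε : 0 < ε := by
    by_contra h
    nlinarith
  set k := ⌊1 / (20 * ε)⌋₊ with hk
  have hk5 : 5 ≤ k := by
    refine Nat.le_floor ?_
    rw [le_div_iff₀ (by positivity)]
    push_cast
    linarith
  have hk1 : (k : ℝ) ≤ 1 / (20 * ε) := Nat.floor_le (by positivity)
  have hk2 : 1 / (20 * ε) < k + 1 := Nat.lt_floor_add_one _
  rw [le_div_iff₀ (by positivity)] at hk1
  rw [div_lt_iff₀ (by positivity)] at hk2
  have hk5' : (5 : ℝ) ≤ k := by exact_mod_cast hk5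
  refine ⟨k, n / (2 * k), hk5, ?_, ?_, ?_⟩
  · rw [← mul_assoc]
    exact Nat.mul_div_le n (2 * k)
  · have h3 : n < 2 * k * (n / (2 * k) + 1) := Nat.lt_mul_div_succ n (by omega)
    have h4 : (n : ℝ) < 2 * k * ((n / (2 * k) : ℕ) + 1) := by exact_mod_cast h3
    set h := n / (2 * k)
    have h5 : (n : ℝ) * (10 * ε) ≤ h + 1 := by
      have : (n : ℝ) * (10 * ε) ≤ 2 * k * ((h : ℝ) + 1) * (10 * ε) :=
        mul_le_mul_of_nonneg_right h4.le (by positivity)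
      have h6 : 2 * k * ((h : ℝ) + 1) * (10 * ε) = k * (20 * ε) * (h + 1) := by ring
      rw [h6] at this
      refine this.trans (mul_le_of_le_one_left (by positivity) hk1)
    linarith
  · nlinarith

theorem three_fifths_le_exp : (3 / 5 : ℝ) ≤ Real.exp (-(1 / 2)) := by
  have h1 := Real.exp_one_lt_d9
  have h2 : Real.exp (1 / 2) * Real.exp (1 / 2) = Real.exp 1 := by
    rw [← Real.exp_add]
    norm_num
  have h3 : Real.exp (1 / 2) ≤ 5 / 3 := by
    by_contra h
    nlinarith [Real.exp_pos (1 / 2)]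
  rw [Real.exp_neg, ← inv_inv (3 / 5 : ℝ)]
  exact inv_anti₀ (Real.exp_pos _) (by linarith)

/-- The possible classes of the vertices: vertex `x` is public and has class `x % k` if
`x < k * h`. -/
def classes (n k h : ℕ) [NeZero k] (x : Fin n) : Finset (Fin k) :=
  if (x : ℕ) < k * h then {Fin.ofNat k x} else Finset.univ

/-- The public part contains `h` vertices of each class. -/
theorem le_card_public {n k h : ℕ} [NeZero k] (hkh : k * h ≤ n) (j : Fin k) :
    h ≤ ((Finset.univ.filter fun x : Fin n => (x : ℕ) < k * h).filter
      fun x : Fin n => Fin.ofNat k x = j).card := by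
  have hj := j.2
  have hlt : ∀ i : Fin h, i * k + j < k * h := fun i => by
    have : ((i : ℕ) + 1) * k ≤ h * k := Nat.mul_le_mul_right k i.2
    nlinarith
  have := Finset.card_le_card_of_injOn
    (s := (Finset.univ : Finset (Fin h))) (t := ((Finset.univ.filter fun x : Fin n =>
      (x : ℕ) < k * h).filter fun x : Fin n => Fin.ofNat k x = j))
    (fun i => ⟨i * k + j, (hlt i).trans_le hkh⟩) (fun i _ => by
      simp only [Finset.coe_filter, Finset.mem_filter, Finset.mem_univ, true_and,
        Set.mem_ofPred_eq]
      refine ⟨hlt i, Fin.ext ?_⟩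
      simp [Nat.mod_eq_of_lt hj]) (fun i _ i' _ hii => by
      have h1 : (i : ℕ) * k + j = i' * k + j := congrArg Fin.val hii
      have h2 : (i : ℕ) * k = i' * k := by omega
      exact Fin.ext (Nat.eq_of_mul_eq_mul_right (Nat.pos_of_ne_zero (NeZero.ne k)) h2))
  simpa using this

/-- Each of the at least `n / 2` vertices that are not public contributes a factor
`(k + 1) / (2 * k) ≤ 3 / 5 ≤ exp (-1 / 2)`. -/
theorem prod_weight_classes_le {n k h : ℕ} [NeZero k] (hk : 5 ≤ k) (hkh : 2 * (k * h) ≤ n) :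
    ∏ x, weight (classes n k h x) ≤
      (Fintype.piFinset (classes n k h)).card * Real.exp (-(n / 4)) := by
  have hk' : (5 : ℝ) ≤ k := by exact_mod_cast hk
  have h1 : ∀ x : Fin n, weight (classes n k h x) ≤
      (classes n k h x).card * (if (x : ℕ) < k * h then 1 else Real.exp (-(1 / 2))) := by
    intro x
    unfold classes
    split_ifs
    · simp [weight_singleton]
    · rw [weight, Finset.card_univ, Fintype.card_fin]
      have : (k : ℝ) * (3 / 5) ≤ k * Real.exp (-(1 / 2)) :=
        mul_le_mul_of_nonneg_left three_fifths_le_exp (by positivity)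
      linarith
  have h2 : ∏ x : Fin n, (if (x : ℕ) < k * h then 1 else Real.exp (-(1 / 2))) ≤
      Real.exp (-(n / 4)) := by
    rw [Finset.prod_ite, Finset.prod_const_one, one_mul, Finset.prod_const, ← Real.exp_nat_mul]
    refine Real.exp_le_exp.2 ?_
    have h3 := Finset.card_filter_add_card_filter_not (s := (Finset.univ : Finset (Fin n)))
      fun x : Fin n => (x : ℕ) < k * h
    have h4 : (Finset.univ.filter fun x : Fin n => (x : ℕ) < k * h).card ≤ k * h := by
      rw [Fin.card_filter_val_lt]
      exact min_le_right _ _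
    rw [Finset.card_univ, Fintype.card_fin] at h3
    have h5 : n ≤ 2 * (Finset.univ.filter fun x : Fin n => ¬ (x : ℕ) < k * h).card := by omega
    have h6 : (n : ℝ) ≤ 2 * (Finset.univ.filter fun x : Fin n => ¬ (x : ℕ) < k * h).card := by
      exact_mod_cast h5
    linarith
  calc _ ≤ ∏ x, ((classes n k h x).card : ℝ) *
        (if (x : ℕ) < k * h then 1 else Real.exp (-(1 / 2))) :=
        Finset.prod_le_prod (fun x _ => (weight_pos _).le) fun x _ => h1 x
    _ ≤ _ := by
        rw [Finset.prod_mul_distrib, Fintype.card_piFinset]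
        push_cast
        exact mul_le_mul_of_nonneg_left h2 (by positivity)

open Classical in
/-- A deterministic algorithm with few queries solves only an exponentially small fraction of the
hard instances. -/
theorem card_isApprox_le {n k h : ℕ} [NeZero k] {c ε : ℝ} (hε : 0 < ε) (hn : 1 ≤ n) (hk : 5 ≤ k)
    (hkh : 2 * (k * h) ≤ n) (hh : 9 * ε * n ≤ h) (hkε : 1 ≤ 25 * ε * k) (t : QueryAlg n)
    (ht : ∀ G, (t.queries G : ℝ) ≤ 1 / 10000 * n / ε) :
    (((Fintype.piFinset (classes n k h)).filter fun σ =>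
      IsApprox (clusterGraph σ) c ε (t.result (clusterGraph σ))).card : ℝ) ≤
      (Fintype.piFinset (classes n k h)).card * Real.exp (-(n / 10)) := by
  have hn' : (0 : ℝ) < n := by exact_mod_cast hn
  have hk' : (5 : ℝ) ≤ k := by exact_mod_cast hk
  set A := Finset.univ.filter fun x : Fin n => (x : ℕ) < k * h
  set τ : Fin n → Fin k := fun x => Fin.ofNat k x
  obtain ⟨guess, hguess⟩ := exists_guess A τ
  set Ω := Fintype.piFinset (classes n k h)
  set q := ⌊1 / 10000 * n / ε⌋₊ with hq
  have hsum := sum_wrong_le guess (by omega) t q (classes n k h) fun x => by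
    unfold classes
    split_ifs
    · exact Or.inr ⟨_, rfl⟩
    · exact Or.inl rfl
  have hwrong : ∀ σ ∈ Ω.filter fun σ =>
      IsApprox (clusterGraph σ) c ε (t.result (clusterGraph σ)),
      Real.exp (-(n / 12)) ≤ (1 / 2 : ℝ) ^ wrong guess σ (t.result (clusterGraph σ)) := by
    intro σ hσ
    obtain ⟨h1, h2⟩ := Finset.mem_filter.1 hσ
    have hστ : ∀ x ∈ A, σ x = τ x := by
      intro x hx
      have h3 := Fintype.mem_piFinset.1 h1 x
      rw [classes, if_pos (Finset.mem_filter.1 hx).2] at h3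
      exact Finset.mem_singleton.1 h3
    have h3 := mul_wrong_le_cost (fun x hx v hv => Fin.lt_def.2 (by
      have h4 := (Finset.mem_filter.1 hx).2
      have h5 : ¬ (v : ℕ) < k * h := fun h5 => hv (Finset.mem_filter.2 ⟨Finset.mem_univ _, h5⟩)
      omega)) (fun j => le_card_public (h := h) (by omega) j) hguess hστ (t.result (clusterGraph σ))
    rw [IsApprox, opt_clusterGraph, Nat.cast_zero, mul_zero, zero_add] at h2
    set W := wrong guess σ (t.result (clusterGraph σ))
    have h4 : (h : ℝ) * W ≤ ε * (n : ℝ) ^ 2 := le_trans (by exact_mod_cast h3) h2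
    have h5 : (W : ℝ) ≤ n / 9 := by
      have h6 : 9 * ε * n * W ≤ h * W := mul_le_mul_of_nonneg_right hh (Nat.cast_nonneg W)
      have h7 : (ε * n) * (9 * W) ≤ (ε * n) * n := by nlinarith
      have h8 := le_of_mul_le_mul_left h7 (by positivity)
      linarith
    have h6 : (1 / 2 : ℝ) ^ W = Real.exp (-(W * Real.log 2)) := by
      rw [Real.exp_neg, Real.exp_nat_mul, Real.exp_log two_pos, one_div, inv_pow]
    rw [h6]
    refine Real.exp_le_exp.2 (neg_le_neg ?_)
    have h7 := Real.log_two_lt_d9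
    have h8 := Real.log_two_gt_d9
    have h9 : (W : ℝ) * Real.log 2 ≤ n / 9 * (3 / 4) :=
      mul_le_mul h5 (by linarith) (by linarith) (by positivity)
    linarith
  have hθ : (1 + 4 / (k : ℝ)) ^ q ≤ Real.exp (n / 100) := by
    have h1 : 1 + 4 / (k : ℝ) ≤ Real.exp (100 * ε) := by
      have h2 := Real.add_one_le_exp (100 * ε)
      have h3 : 4 / (k : ℝ) ≤ 100 * ε := by
        rw [div_le_iff₀ (by positivity)]
        linarith
      linarith
    refine (pow_le_pow_left₀ (by positivity) h1 q).trans ?_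
    rw [← Real.exp_nat_mul]
    refine Real.exp_le_exp.2 ?_
    have h2 : (q : ℝ) ≤ 1 / 10000 * n / ε := Nat.floor_le (by positivity)
    rw [le_div_iff₀ hε] at h2
    linarith
  have hmain : (((Ω.filter fun σ =>
      IsApprox (clusterGraph σ) c ε (t.result (clusterGraph σ))).card : ℝ)) *
      Real.exp (-(n / 12)) ≤ Real.exp (n / 100) * (Ω.card * Real.exp (-(n / 4))) := by
    rw [← nsmul_eq_mul]
    refine (Finset.card_nsmul_le_sum _ _ _ hwrong).trans ?_
    refine le_trans ?_ (hsum.trans (mul_le_mul hθ (prod_weight_classes_le hk hkh)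
      (Finset.prod_nonneg fun x _ => (weight_pos _).le) (Real.exp_pos _).le))
    refine Finset.sum_le_sum_of_subset_of_nonneg (fun σ hσ => ?_) fun σ _ _ => by positivity
    exact Finset.mem_filter.2 ⟨(Finset.mem_filter.1 hσ).1, Nat.le_floor (ht _)⟩
  -- `1 / 12 + 1 / 100 - 1 / 4 < -1 / 10`
  refine le_of_mul_le_mul_right (hmain.trans ?_) (Real.exp_pos (-(n / 12)))
  rw [mul_left_comm, mul_assoc, ← Real.exp_add, ← Real.exp_add]
  refine mul_le_mul_of_nonneg_left (Real.exp_le_exp.2 ?_) (Nat.cast_nonneg _)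
  linarith

/-- Averaging over the hard instances: a randomised algorithm with few queries fails with
probability exponentially close to `1` on one of them. -/
theorem success_le {n : ℕ} {c ε p : ℝ} (h1 : 1 < ε * n) (h2 : ε < 1 / 100) (A : PMF (QueryAlg n))
    (hA : ∀ G : SimpleGraph (Fin n),
      ENNReal.ofReal p ≤ A.toOuterMeasure {t | IsApprox G c ε (t.result G)})
    (ht : ∀ t ∈ A.support, ∀ G, (t.queries G : ℝ) ≤ 1 / 10000 * n / ε) :
    p ≤ Real.exp (-(n / 10)) := by
  classical
  obtain ⟨k, h, hk, hkh, hh, hkε⟩ := exists_parameters h1 h2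
  have : NeZero k := ⟨by omega⟩
  have hn : 1 ≤ n := by
    by_contra hn
    have : n = 0 := by omega
    subst this
    norm_num at h1
  have hε : 0 < ε := by
    by_contra hε
    nlinarith [(Nat.cast_nonneg n : (0 : ℝ) ≤ n)]
  set Ω := Fintype.piFinset (classes n k h) with hΩ
  have hΩ0 : 0 < Ω.card := by
    rw [Finset.card_pos, hΩ, Fintype.piFinset_nonempty]
    intro x
    unfold classes
    split_ifs
    · exact Finset.singleton_nonempty _
    · exact Finset.univ_nonempty
  set E := Real.exp (-(n / 10))
  have key : (Ω.card : ENNReal) * ENNReal.ofReal p ≤ Ω.card * ENNReal.ofReal E := by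
    calc (Ω.card : ENNReal) * ENNReal.ofReal p = ∑ _σ ∈ Ω, ENNReal.ofReal p := by
          rw [Finset.sum_const, nsmul_eq_mul]
      _ ≤ ∑ σ ∈ Ω, ∑' t, A t *
          (if IsApprox (clusterGraph σ) c ε (t.result (clusterGraph σ)) then 1 else 0) := by
          refine Finset.sum_le_sum fun σ _ => (hA (clusterGraph σ)).trans (le_of_eq ?_)
          rw [PMF.toOuterMeasure_apply]
          refine tsum_congr fun t => ?_
          simp [Set.indicator_apply]
      _ = ∑' t, A t * ((Ω.filter fun σ =>
          IsApprox (clusterGraph σ) c ε (t.result (clusterGraph σ))).card : ENNReal) := by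
          rw [← Summable.tsum_finsetSum fun _ _ => ENNReal.summable]
          refine tsum_congr fun t => ?_
          rw [← Finset.mul_sum, Finset.sum_boole]
      _ ≤ ∑' t, A t * (Ω.card * ENNReal.ofReal E) := by
          refine ENNReal.tsum_le_tsum fun t => ?_
          by_cases hAt : A t = 0
          · rw [hAt, zero_mul, zero_mul]
          · refine mul_le_mul_right ?_ _
            have h3 := card_isApprox_le (c := c) hε hn hk hkh hh hkε t
              (ht t ((PMF.mem_support_iff ..).2 hAt))
            have h4 := ENNReal.ofReal_le_ofReal h3
            rwa [ENNReal.ofReal_natCast, ENNReal.ofReal_mul (Nat.cast_nonneg _),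
              ENNReal.ofReal_natCast] at h4
      _ = _ := by rw [ENNReal.tsum_mul_right, A.tsum_coe, one_mul]
  have h3 : (Ω.card : ENNReal) ≠ 0 := by exact_mod_cast hΩ0.ne'
  exact (ENNReal.ofReal_le_ofReal_iff (Real.exp_pos _).le).1
    ((ENNReal.mul_le_mul_iff_right h3 (ENNReal.natCast_ne_top _)).1 key)

theorem lower_bound (c : ℝ) (hc : 1 ≤ c) (p : ℝ) (hp : 0 < p) : ∃ κ : ℝ, 0 < κ ∧ ∃ n₀ : ℕ,
    ∀ n : ℕ, n₀ ≤ n → ∀ ε : ℝ, 1 / (n : ℝ) < ε → ε < 1 / (100 * c) →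
      ∀ A : PMF (QueryAlg n),
        (∀ G : SimpleGraph (Fin n),
          ENNReal.ofReal p ≤ A.toOuterMeasure {t | IsApprox G c ε (t.result G)}) →
        ∃ G : SimpleGraph (Fin n), ∃ t ∈ A.support, κ * (n : ℝ) / ε ≤ (t.queries G : ℝ) := by
  refine ⟨1 / 10000, by norm_num, ⌈10 / p⌉₊ + 1, fun n hn ε h1 h2 A hA => ?_⟩
  by_contra! h3
  have hn0 : (0 : ℝ) < n := by exact_mod_cast (Nat.succ_pos _).trans_le hn
  have h4 : 1 < ε * n := by rwa [div_lt_iff₀ hn0] at h1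
  have h5 : ε < 1 / 100 := by
    refine h2.trans_le ?_
    gcongr
    linarith
  have h6 := success_le h4 h5 A hA fun t ht G => (h3 G t ht).le
  have h7 : 10 / p ≤ n := (Nat.le_ceil _).trans (by exact_mod_cast (Nat.le_succ _).trans hn)
  rw [div_le_iff₀ hp] at h7
  have h8 := Real.add_one_le_exp ((n : ℝ) / 10)
  rw [Real.exp_neg] at h6
  have h9 := mul_le_mul_of_nonneg_right h6 (Real.exp_pos ((n : ℝ) / 10)).le
  rw [inv_mul_cancel₀ (Real.exp_pos _).ne'] at h9
  nlinarith

end LowerBound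

end CorrClust

open CorrClust in
theorem theorem3p3 :
    -- Upper bound: one program `P` finds a (4, ε)-approximation in time at most `C * n / ε`.
    (∃ (P : Prog) (K : ℕ) (C : ℝ), 0 < C ∧
      ∀ ε : ℝ, 0 < ε → ε < 1 → ∀ n : ℕ, 1 ≤ n → ∀ G : SimpleGraph (Fin n),
        (∀ D ∈ (run (wordLength K n ⌈1 / ε⌉₊) G ⌊C * (n : ℝ) / ε⌋₊
            (start P n ⌈1 / ε⌉₊)).support, D.Halted) ∧
        2 / 3 ≤ (run (wordLength K n ⌈1 / ε⌉₊) G ⌊C * (n : ℝ) / ε⌋₊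
            (start P n ⌈1 / ε⌉₊)).toOuterMeasure {D | IsApprox G 4 ε (D.clustering n)}) ∧
    -- Lower bound, for every approximation constant `c` and every success probability `p`.
    (∀ c : ℝ, 1 ≤ c → ∀ p : ℝ, 0 < p → ∃ κ : ℝ, 0 < κ ∧ ∃ n₀ : ℕ,
      ∀ n : ℕ, n₀ ≤ n → ∀ ε : ℝ, 1 / (n : ℝ) < ε → ε < 1 / (100 * c) →
        ∀ A : PMF (QueryAlg n),
          (∀ G : SimpleGraph (Fin n),
            ENNReal.ofReal p ≤ A.toOuterMeasure {t | IsApprox G c ε (t.result G)}) →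
          ∃ G : SimpleGraph (Fin n), ∃ t ∈ A.support, κ * (n : ℝ) / ε ≤ (t.queries G : ℝ)) := by
  refine ⟨⟨clusterProg, 23, 2 ^ 30, by norm_num, fun ε hε hε1 n hn G => ?_⟩, lower_bound⟩
  have h := clusterProg_correct hε hε1 hn G
  exact ⟨halted_of_expect_failure_ne_top h, le_prob_isApprox h⟩
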